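/- Let $n\ge 1$, $s\in(0,1)$, and let $\Omega\subset\mathbb{R}^n$ be a bounded open set with smooth boundary (i.e. near each boundary point, up to a choice of unit vector $\nu$, $\Omega$ is the set of points whose $\nu$-coordinate lies strictly above the graph of a $C^\infty$ function of the coordinates orthogonal to $\nu$). Write $\Omega^c=\mathbb{R}^n\setminus\overline\Omega$. For an open set $A\subset\mathbb{R}^n$, let $H^s(A)$ be the space of real-valued $v\in L^2(A)$ with $$|v|_{H^s(A)}^2=\iint_{A\times A}\frac{|v(x)-v(y)|^2}{|x-y|^{n+2s}}\,dx\,dy<\infty,\qquad \|v\|_{H^s(A)}^2=\|v\|_{L^2(A)}^2+|v|_{H^s(A)}^2,$$ and let $\widetilde H^{-s}(A)=(H^s(A))'$ be its dual space with the dual norm. Put $V=H^s(\mathbb{R}^n)$ and $\Lambda=\widetilde H^{-s}(\Omega^c)=(H^s(\Omega^c))'$. With $Q=(\Omega\times\mathbb{R}^n)\cup(\mathbb{R}^n\times\Omega)$ and $C(n,s)=\dfrac{2^{2s}\,s\,\Gamma(s+\frac n2)}{\pi^{n/2}\,\Gamma(1-s)}$, define for $u,v\in V$ and $\mu\in\Lambda$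 $$a(u,v)=\frac{C(n,s)}{2}\iint_Q\frac{(u(x)-u(y))(v(x)-v(y))}{|x-y|^{n+2s}}\,dx\,dy,\qquad b(u,\mu)=\langle\mu,u|_{\Omega^c}\rangle ,$$ and, for $f\in\widetilde H^{-s}(\Omega)$ and $g\in H^s(\Omega^c)$, $F(v)=\langle f,v|_\Omega\rangle$ and $G(\mu)=\langle\mu,g\rangle$. Then for every $f\in\widetilde H^{-s}(\Omega)$ and $g\in H^s(\Omega^c)$ the mixed problem $$a(u,v)-b(v,\lambda)=F(v)\quad\forall v\in V,\qquad b(u,\mu)=G(\mu)\quad\forall\mu\in\Lambda$$ has a unique solution $(u,\lambda)\in V\times\Lambda$, this solution satisfies $u=g$ almost everywhere in $\Omega^c$, and there is a constant $C>0$, depending only on $n$, $s$ and $\Omega$, such that for all such $f$ and $g$ $$\|u\|_V+\|\lambda\|_\Lambda\le C\left(\|f\|_{\widetilde H^{-s}(\Omega)}+\|g\|_{H^s(\Omega^c)}\right).$$ -/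

import Mathlib

open MeasureTheory Set
open scoped ENNReal ContDiff

noncomputable section

namespace FracDirichlet

/-- The Euclidean space `ℝⁿ`. -/
abbrev Rn (n : ℕ) : Type := EuclideanSpace ℝ (Fin n)

variable {n : ℕ}

/-! ### Fractional Sobolev spaces -/

/-- The integrand `(u(x) - u(y)) (v(x) - v(y)) / |x - y|^(n + 2s)` at the pair `p = (x, y)`. -/
def gagliardo (s : ℝ) (u v : Rn n → ℝ) (p : Rn n × Rn n) : ℝ :=
  (u p.1 - u p.2) * (v p.1 - v p.2) / ‖p.1 - p.2‖ ^ ((n : ℝ) + 2 * s)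

lemma ae_fst_snd {A : Set (Rn n)} {P : Rn n → Prop} (h : ∀ᵐ x ∂(volume.restrict A), P x) :
    ∀ᵐ p ∂((volume : Measure (Rn n × Rn n)).restrict (A ×ˢ A)), P p.1 ∧ P p.2 := by
  rw [Measure.volume_eq_prod, ← Measure.prod_restrict]
  exact (Measure.quasiMeasurePreserving_fst.ae h).and (Measure.quasiMeasurePreserving_snd.ae h)

lemma gagliardo_meas (s : ℝ) {u v : Rn n → ℝ} (hu : Measurable u) (hv : Measurable v) :
    Measurable (gagliardo s u v) := by
  unfold gagliardo
  fun_prop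

lemma gagliardo_self_nonneg (s : ℝ) (u : Rn n → ℝ) (p : Rn n × Rn n) :
    0 ≤ gagliardo s u u p := by
  unfold gagliardo
  have := mul_self_nonneg (u p.1 - u p.2)
  positivity

lemma abs_gagliardo_le (s : ℝ) (u v : Rn n → ℝ) (p : Rn n × Rn n) :
    |gagliardo s u v p| ≤ gagliardo s u u p + gagliardo s v v p := by
  unfold gagliardo
  have hk : 0 ≤ ‖p.1 - p.2‖ ^ ((n : ℝ) + 2 * s) := by positivity
  rw [abs_div, abs_of_nonneg hk, ← add_div]
  gcongr
  rw [abs_le]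
  constructor <;> nlinarith [sq_nonneg (u p.1 - u p.2 + (v p.1 - v p.2)),
    sq_nonneg (u p.1 - u p.2 - (v p.1 - v p.2)), sq_nonneg (u p.1 - u p.2),
    sq_nonneg (v p.1 - v p.2)]

/-- The real Hilbert space `L²(A)`. -/
abbrev L2 (A : Set (Rn n)) : Type := Lp ℝ 2 ((volume : Measure (Rn n)).restrict A)

lemma L2.measurable {A : Set (Rn n)} (v : L2 A) : Measurable (v : Rn n → ℝ) :=
  (Lp.stronglyMeasurable v).measurable

lemma gagliardo_add_left {A : Set (Rn n)} (s : ℝ) (u v w : L2 A) :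
    gagliardo s (u + v : L2 A) w =ᵐ[(volume : Measure (Rn n × Rn n)).restrict (A ×ˢ A)]
      fun p => gagliardo s u w p + gagliardo s v w p := by
  filter_upwards [ae_fst_snd (Lp.coeFn_add u v)] with p hp
  simp only [gagliardo, hp.1, hp.2, Pi.add_apply]
  ring

lemma gagliardo_smul_left {A : Set (Rn n)} (s : ℝ) (c : ℝ) (u w : L2 A) :
    gagliardo s (c • u : L2 A) w =ᵐ[(volume : Measure (Rn n × Rn n)).restrict (A ×ˢ A)]
      fun p => c * gagliardo s u w p := by
  filter_upwards [ae_fst_snd (Lp.coeFn_smul c u)] with p hp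
  simp only [gagliardo, hp.1, hp.2, Pi.smul_apply, smul_eq_mul]
  ring

lemma gagliardo_comm (s : ℝ) (u v : Rn n → ℝ) : gagliardo s u v = gagliardo s v u := by
  funext p
  simp only [gagliardo, mul_comm]

lemma gagliardo_integrable {A : Set (Rn n)} {s : ℝ} {u v : L2 A}
    (hu : IntegrableOn (gagliardo s u u) (A ×ˢ A)) (hv : IntegrableOn (gagliardo s v v) (A ×ˢ A)) :
    IntegrableOn (gagliardo s u v) (A ×ˢ A) :=
  Integrable.mono' (hu.add hv) (gagliardo_meas s u.measurable v.measurable).aestronglyMeasurable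
    (Filter.Eventually.of_forall fun p => abs_gagliardo_le s u v p)

/-- The functions `v ∈ L²(A)` whose Aronszajn-Slobodeckij seminorm
`|v|² = ∬_{A × A} |v(x) - v(y)|² / |x - y|^(n + 2s) dx dy` is finite. -/
def sobolevSubmodule (s : ℝ) (A : Set (Rn n)) : Submodule ℝ (L2 A) where
  carrier := {v | IntegrableOn (gagliardo s v v) (A ×ˢ A)}
  zero_mem' := by
    have h := gagliardo_smul_left s (0 : ℝ) (0 : L2 A) (0 : L2 A)
    simp only [zero_smul, zero_mul] at h
    exact (integrable_zero _ _ _).congr h.symm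
  add_mem' := by
    intro u v hu hv
    have h1 : IntegrableOn (gagliardo s u (u + v : L2 A)) (A ×ˢ A) := by
      rw [gagliardo_comm]
      exact (Integrable.add hu (gagliardo_integrable hv hu)).congr (gagliardo_add_left s u v u).symm
    have h2 : IntegrableOn (gagliardo s v (u + v : L2 A)) (A ×ˢ A) := by
      rw [gagliardo_comm]
      exact (Integrable.add (gagliardo_integrable hu hv) hv).congr (gagliardo_add_left s u v v).symm
    exact (Integrable.add h1 h2).congr (gagliardo_add_left s u v (u + v : L2 A)).symm
  smul_mem' := by
    intro c u hu
    have h1 : IntegrableOn (gagliardo s u (c • u : L2 A)) (A ×ˢ A) := by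
      rw [gagliardo_comm]
      exact (Integrable.const_mul hu c).congr (gagliardo_smul_left s c u u).symm
    exact (Integrable.const_mul h1 c).congr (gagliardo_smul_left s c u (c • u : L2 A)).symm

/-- The fractional Sobolev space `H^s(A)`.  As a vector space it is a subspace of `L²(A)`; it is a
separate type because it carries the `H^s` norm and not the one of `L²(A)`. -/
def Hs (s : ℝ) (A : Set (Rn n)) : Type := ↥(sobolevSubmodule s A)

namespace Hs

variable {s : ℝ} {A : Set (Rn n)}

/-- The element of `L²(A)` underlying an element of `H^s(A)`. -/
def toL2 (u : Hs s A) : L2 A := u.1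

lemma integrableOn (u v : Hs s A) : IntegrableOn (gagliardo s u.toL2 v.toL2) (A ×ˢ A) :=
  gagliardo_integrable u.2 v.2

/-- The form `⟨u, v⟩_{H^s(A)}` associated with the Aronszajn-Slobodeckij seminorm. -/
def seminormForm (u v : Hs s A) : ℝ := ∫ p in A ×ˢ A, gagliardo s u.toL2 v.toL2 p

instance instAddCommGroup : AddCommGroup (Hs s A) :=
  inferInstanceAs (AddCommGroup ↥(sobolevSubmodule s A))

instance instModule : Module ℝ (Hs s A) :=
  inferInstanceAs (Module ℝ ↥(sobolevSubmodule s A))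

/-- The inner product `(u, v)_{L²(A)} + ⟨u, v⟩_{H^s(A)}` of `H^s(A)`. -/
@[reducible] def core (s : ℝ) (A : Set (Rn n)) : InnerProductSpace.Core ℝ (Hs s A) :=
  { inner := fun u v => inner ℝ u.toL2 v.toL2 + seminormForm u v
    conj_inner_symm := fun u v => by
      simp only [seminormForm, conj_trivial]
      rw [gagliardo_comm, real_inner_comm]
    re_inner_nonneg := fun u => by
      have h1 : 0 ≤ inner ℝ u.toL2 u.toL2 := real_inner_self_nonneg
      have h2 : 0 ≤ seminormForm u u := integral_nonneg (gagliardo_self_nonneg s _)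
      simpa using add_nonneg h1 h2
    add_left := fun u v w => by
      have h : seminormForm (u + v) w = seminormForm u w + seminormForm v w := by
        unfold seminormForm
        rw [← integral_add (integrableOn u w) (integrableOn v w)]
        exact integral_congr_ae (gagliardo_add_left s u.toL2 v.toL2 w.toL2)
      have h' : (u + v).toL2 = u.toL2 + v.toL2 := rfl
      simp only [h, h', inner_add_left]
      ring
    smul_left := fun u w c => by
      have h : seminormForm (c • u) w = c * seminormForm u w := by
        unfold seminormForm
        rw [← integral_const_mul]
        exact integral_congr_ae (gagliardo_smul_left s c u.toL2 w.toL2)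
      have h' : (c • u).toL2 = c • u.toL2 := rfl
      simp only [h, h', real_inner_smul_left, conj_trivial]
      ring
    definite := fun u hu => by
      have h1 : 0 ≤ inner ℝ u.toL2 u.toL2 := real_inner_self_nonneg
      have h2 : 0 ≤ seminormForm u u := integral_nonneg (gagliardo_self_nonneg s _)
      have h3 : inner ℝ u.toL2 u.toL2 = (0 : ℝ) := by
        have h4 : inner ℝ u.toL2 u.toL2 + seminormForm u u = 0 := hu
        linarith
      exact Subtype.ext (inner_self_eq_zero.1 h3) }

instance instNormedAddCommGroup : NormedAddCommGroup (Hs s A) :=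
  @InnerProductSpace.Core.toNormedAddCommGroup ℝ (Hs s A) _ _ _ (core s A)

instance instInnerProductSpace : InnerProductSpace ℝ (Hs s A) :=
  @InnerProductSpace.ofCore ℝ (Hs s A) _ _ _ (core s A).toCore

/-- `‖v‖²_{H^s(A)} = ‖v‖²_{L²(A)} + |v|²_{H^s(A)}`. -/
lemma norm_sq (v : Hs s A) : ‖v‖ ^ 2 = ‖v.toL2‖ ^ 2 + seminormForm v v := by
  rw [← real_inner_self_eq_norm_sq, ← real_inner_self_eq_norm_sq]
  rfl

lemma restrict_memLp {B : Set (Rn n)} (h : B ⊆ A) (v : L2 A) :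
    MemLp v 2 ((volume : Measure (Rn n)).restrict B) :=
  (Lp.memLp v).mono_measure (Measure.restrict_mono_set _ h)

lemma restrict_mem {B : Set (Rn n)} (h : B ⊆ A) (v : Hs s A) :
    (restrict_memLp h v.toL2).toLp v.toL2 ∈ sobolevSubmodule s B := by
  have h1 : IntegrableOn (gagliardo s v.toL2 v.toL2) (B ×ˢ B) :=
    (integrableOn v v).mono_set (Set.prod_mono h h)
  refine h1.congr ?_
  filter_upwards [ae_fst_snd (restrict_memLp h v.toL2).coeFn_toLp] with p hp
  simp only [gagliardo, hp.1, hp.2]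

/-- The restriction `v ↦ v|_B` from `H^s(A)` to `H^s(B)`, for `B ⊆ A`. -/
def restrict {B : Set (Rn n)} (h : B ⊆ A) : Hs s A →ₗ[ℝ] Hs s B where
  toFun v := ⟨(restrict_memLp h v.toL2).toLp v.toL2, restrict_mem h v⟩
  map_add' u v := by
    refine Subtype.ext ?_
    refine Eq.trans ?_ (MemLp.toLp_add (restrict_memLp h u.toL2) (restrict_memLp h v.toL2))
    exact MemLp.toLp_congr (restrict_memLp h (u + v).toL2) _
      (ae_mono (Measure.restrict_mono_set _ h) (Lp.coeFn_add u.toL2 v.toL2))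
  map_smul' c v := by
    refine Subtype.ext ?_
    refine Eq.trans ?_ (MemLp.toLp_const_smul c (restrict_memLp h v.toL2))
    exact MemLp.toLp_congr (restrict_memLp h (c • v).toL2) _
      (ae_mono (Measure.restrict_mono_set _ h) (Lp.coeFn_smul c v.toL2))

end Hs

/-! ### Smooth domains -/

/-- `Ω` has smooth boundary: near every boundary point there are a unit vector `ν` and a smooth
function `γ` of the coordinates orthogonal to `ν` such that `Ω` is locally the set of points whose
`ν`-coordinate exceeds `γ`. -/
def HasSmoothBoundary (Ω : Set (Rn n)) : Prop :=
  ∀ x₀ ∈ frontier Ω, ∃ r > 0, ∃ ν : Rn n, ‖ν‖ = 1 ∧ ∃ γ : Rn n → ℝ, ContDiff ℝ ∞ γ ∧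
    ∀ x ∈ Metric.ball x₀ r, x ∈ Ω ↔ γ (x - inner ℝ ν x • ν) < inner ℝ ν x

/-! ### The mixed formulation -/

/-- The space `V = H^s(ℝⁿ)`. -/
abbrev SpaceV (n : ℕ) (s : ℝ) : Type := Hs s (univ : Set (Rn n))

/-- The exterior `Ω^c = ℝⁿ \ closure Ω`. -/
abbrev exterior (Ω : Set (Rn n)) : Set (Rn n) := (closure Ω)ᶜ

/-- The space `H̃^{-s}(A) = (H^s(A))'` with the dual norm; `Λ` is `HsDual s (exterior Ω)`. -/
abbrev HsDual (s : ℝ) (A : Set (Rn n)) : Type := StrongDual ℝ (Hs s A)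

/-- The normalization constant `C(n, s)` of the fractional Laplacian. -/
def normConst (n : ℕ) (s : ℝ) : ℝ :=
  2 ^ (2 * s) * s * Real.Gamma (s + n / 2) / (Real.pi ^ ((n : ℝ) / 2) * Real.Gamma (1 - s))

/-- The form `a(u, v) = C(n, s) / 2 ∬_Q (u(x) - u(y)) (v(x) - v(y)) / |x - y|^(n + 2s) dx dy` with
`Q = (Ω × ℝⁿ) ∪ (ℝⁿ × Ω)`. -/
def formA {s : ℝ} (Ω : Set (Rn n)) (u v : SpaceV n s) : ℝ :=
  normConst n s / 2 *
    ∫ p in (Ω ×ˢ (univ : Set (Rn n))) ∪ ((univ : Set (Rn n)) ×ˢ Ω), gagliardo s u.toL2 v.toL2 p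

/-- The form `b(u, μ) = ∫_{Ω^c} u μ`: the duality pairing of `μ ∈ Λ` with `u|_{Ω^c}`. -/
def formB {s : ℝ} (Ω : Set (Rn n)) (u : SpaceV n s) (μ : HsDual s (exterior Ω)) : ℝ :=
  μ (Hs.restrict (subset_univ (exterior Ω)) u)

/-- The functional `F(v) = ∫_Ω f v`: the duality pairing of `f` with `v|_Ω`. -/
def functionalF {s : ℝ} (Ω : Set (Rn n)) (f : HsDual s Ω) (v : SpaceV n s) : ℝ :=
  f (Hs.restrict (subset_univ Ω) v)

/-- The functional `G(μ) = ∫_{Ω^c} g μ`: the duality pairing of `μ ∈ Λ` with `g`. -/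
def functionalG {s : ℝ} (Ω : Set (Rn n)) (g : Hs s (exterior Ω)) (μ : HsDual s (exterior Ω)) : ℝ := μ g

/-- The pair `(u, lam)` solves the mixed formulation with data `f` and `g`. -/
def IsMixedSolution {s : ℝ} (Ω : Set (Rn n)) (f : HsDual s Ω) (g : Hs s (exterior Ω)) (u : SpaceV n s)
    (lam : HsDual s (exterior Ω)) : Prop :=
  (∀ v : SpaceV n s, formA Ω u v - formB Ω v lam = functionalF Ω f v) ∧
    ∀ μ : HsDual s (exterior Ω), formB Ω u μ = functionalG Ω g μ

end FracDirichlet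

end

open FracDirichlet

open scoped NNReal

namespace FracDirichlet

variable {n : ℕ} {s : ℝ} {A B : Set (Rn n)} {u v : Rn n → ℝ}

/-! ### Functions of class `H^s` -/

/-! The problem is a saddle point problem of Brezzi type. Let `R` be the restriction of `H^s(ℝⁿ)` to
the exterior. Since functionals separate points, the second equation says exactly `R u = g`. Two
facts then suffice: `R` is surjective, and `a` is coercive on `ker R`. Given a lift of `g`,
Lax-Milgram on `ker R` determines `u`. The residual `a(u, ·) - F` vanishes on `ker R`, so it factors
through `R` as the multiplier (`exists_mixed_solution`). The open mapping theorem plays the role of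
the inf-sup condition and yields the bound (`exists_mixed_bound`); uniqueness is this bound applied
to a difference of solutions. Completeness of `H^s` enters both through Lax-Milgram and through open
mapping.

Coercivity (`exists_coercive_formA`): if `u` vanishes on the exterior, it vanishes a.e. off `Ω`
because the boundary is null, so the integral over `Q` is the whole seminorm. Comparing `Ω` with a
ball on which `u = 0` gives a Poincaré inequality.

Surjectivity (`MemHs.exists_extension`) is the long part. Near a boundary point, the side of `Ω` is
folded onto the exterior side by reflection in a Lipschitz graph; composition with the fold
preserves `H^s`. Compactness of the boundary combines the local extensions and leaves a remainder
that vanishes near the boundary and can be extended by zero. Multiplication by cutoffs and extension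
by zero both create errors controlled by the integrable kernel `truncKernel`. -/

/-- The measurable functions representing an element of `H^s(A)`. -/
structure MemHs (s : ℝ) (A : Set (Rn n)) (u : Rn n → ℝ) : Prop where
  measurable : Measurable u
  integrableOn_sq : IntegrableOn (fun x => u x ^ 2) A
  integrableOn_gagliardo : IntegrableOn (gagliardo s u u) (A ×ˢ A)

lemma gagliardo_self (s : ℝ) (u : Rn n → ℝ) (p : Rn n × Rn n) :
    gagliardo s u u p = (u p.1 - u p.2) ^ 2 / ‖p.1 - p.2‖ ^ ((n : ℝ) + 2 * s) := by
  rw [gagliardo, sq]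

lemma gagliardo_congr_ae (h : u =ᵐ[volume.restrict A] v) :
    gagliardo s u u =ᵐ[(volume : Measure (Rn n × Rn n)).restrict (A ×ˢ A)] gagliardo s v v := by
  filter_upwards [ae_fst_snd h] with p hp
  simp only [gagliardo, hp.1, hp.2]

lemma MemHs.congr (hu : MemHs s A u) (hv : Measurable v) (h : u =ᵐ[volume.restrict A] v) :
    MemHs s A v :=
  ⟨hv, hu.2.congr (h.mono fun x hx => by simp only [hx]), hu.3.congr (gagliardo_congr_ae h)⟩

lemma MemHs.mono (hu : MemHs s A u) (h : B ⊆ A) : MemHs s B u :=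
  ⟨hu.1, hu.2.mono_set h, hu.3.mono_set (prod_mono h h)⟩

lemma MemHs.memLp (hu : MemHs s A u) : MemLp u 2 (volume.restrict A) :=
  (memLp_two_iff_integrable_sq hu.1.aestronglyMeasurable).2 hu.2

lemma Hs.memHs (u : Hs s A) : MemHs s A u.toL2 :=
  ⟨u.toL2.measurable,
    (memLp_two_iff_integrable_sq (Lp.memLp u.toL2).aestronglyMeasurable).1 (Lp.memLp u.toL2), u.2⟩

lemma MemHs.mem_sobolevSubmodule (hu : MemHs s A u) :
    hu.memLp.toLp u ∈ sobolevSubmodule s A :=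
  hu.3.congr (gagliardo_congr_ae hu.memLp.coeFn_toLp.symm)

/-- The element of `H^s(A)` represented by `u`. -/
noncomputable def MemHs.toHs (hu : MemHs s A u) : Hs s A :=
  ⟨hu.memLp.toLp u, hu.mem_sobolevSubmodule⟩

lemma MemHs.coeFn_toHs (hu : MemHs s A u) : hu.toHs.toL2 =ᵐ[volume.restrict A] u :=
  hu.memLp.coeFn_toLp

lemma Hs.ext_ae {u v : Hs s A} (h : u.toL2 =ᵐ[volume.restrict A] v.toL2) : u = v :=
  Subtype.ext (Lp.ext h)

lemma Hs.coeFn_restrict (h : B ⊆ A) (v : Hs s A) :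
    (Hs.restrict h v).toL2 =ᵐ[volume.restrict B] v.toL2 :=
  (Hs.restrict_memLp h v.toL2).coeFn_toLp

lemma Hs.coeFn_sub (u v : Hs s A) :
    (u - v).toL2 =ᵐ[volume.restrict A] fun x => u.toL2 x - v.toL2 x :=
  Lp.coeFn_sub u.toL2 v.toL2

/-! ### The truncated kernel -/

/-- The integrable kernel `min 1 |z|² / |z|^(n + 2s)`. -/
noncomputable def truncKernel (s : ℝ) (z : Rn n) : ℝ := min 1 (‖z‖ ^ 2) / ‖z‖ ^ ((n : ℝ) + 2 * s)

lemma truncKernel_nonneg (s : ℝ) (z : Rn n) : 0 ≤ truncKernel s z := by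
  unfold truncKernel; positivity

lemma truncKernel_neg (s : ℝ) (z : Rn n) : truncKernel s (-z) = truncKernel s z := by
  simp [truncKernel]

/-- In polar coordinates the radial density is `t^(1-2s)` on `(0,1]` and `t^(-1-2s)` beyond: `s < 1`
gives convergence at the origin, `0 < s` at infinity. -/
lemma integrable_truncKernel (hn : 1 ≤ n) (hs0 : 0 < s) (hs1 : s < 1) :
    Integrable (truncKernel s : Rn n → ℝ) := by
  have : Nonempty (Fin n) := ⟨⟨0, hn⟩⟩
  have : Nontrivial (Rn n) := inferInstance
  have key := integrable_fun_norm_addHaar (E := Rn n) volume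
    (f := fun t : ℝ => min 1 (t ^ 2) / t ^ ((n : ℝ) + 2 * s))
  refine key.2 ?_
  rw [finrank_euclideanSpace_fin, ← Ioc_union_Ioi_eq_Ioi zero_le_one]
  -- The factor `t^(n-1)` cancels the polar Jacobian.
  have hpow : ∀ t : ℝ, 0 < t → t ^ ((n : ℝ) + 2 * s) = t ^ (n - 1) * t ^ (1 + 2 * s) := by
    intro t ht
    rw [← Real.rpow_natCast, ← Real.rpow_add ht]
    congr 1
    push_cast [hn]
    ring
  refine IntegrableOn.union ?_ ?_
  · have h : IntegrableOn (fun t : ℝ => t ^ (1 - 2 * s)) (Ioc 0 1) :=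
      (intervalIntegral.intervalIntegrable_rpow' (by linarith)).1
    refine h.congr_fun (fun t ht => ?_) measurableSet_Ioc
    have ht0 : 0 < t := ht.1
    have h1 : t ^ 2 ≤ 1 := pow_le_one₀ ht0.le ht.2
    simp only [smul_eq_mul, min_eq_right h1, hpow t ht0]
    rw [mul_div_mul_left _ _ (by positivity) |> (mul_div_assoc _ _ _).symm.trans,
      show (1 - 2 * s) = 2 - (1 + 2 * s) by ring, Real.rpow_sub ht0, Real.rpow_two]
  · have h : IntegrableOn (fun t : ℝ => t ^ (-(1 + 2 * s))) (Ioi 1) :=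
      integrableOn_Ioi_rpow_of_lt (by linarith) one_pos
    refine h.congr_fun (fun t ht => ?_) measurableSet_Ioi
    have ht1 : 1 < t := ht
    have ht0 : 0 < t := one_pos.trans ht1
    have h1 : 1 ≤ t ^ 2 := one_le_pow₀ ht1.le
    simp only [smul_eq_mul, min_eq_left h1, hpow t ht0]
    rw [mul_div_mul_left _ _ (by positivity) |> (mul_div_assoc _ _ _).symm.trans,
      Real.rpow_neg ht0.le, one_div]

/-- The term in `u p.2` is the integrand of a convolution of two integrable functions. The other
term follows by swapping variables, the kernel being even. -/
lemma integrableOn_sq_mul_truncKernel (hn : 1 ≤ n) (hs0 : 0 < s) (hs1 : s < 1)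
    (hu : IntegrableOn (fun x => u x ^ 2) A) :
    IntegrableOn (fun p : Rn n × Rn n => (u p.1 ^ 2 + u p.2 ^ 2) * truncKernel s (p.1 - p.2))
      (A ×ˢ A) := by
  have h2 := Integrable.convolution_integrand (ContinuousLinearMap.mul ℝ ℝ)
    (μ := (volume : Measure (Rn n))) (ν := volume.restrict A) hu (integrable_truncKernel hn hs0 hs1)
  have h2' : IntegrableOn (fun p : Rn n × Rn n => u p.2 ^ 2 * truncKernel s (p.1 - p.2))
      (A ×ˢ A) := by
    refine Integrable.mono_measure h2 ?_
    rw [Measure.volume_eq_prod, ← Measure.prod_restrict]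
    exact Measure.prod_mono Measure.restrict_le_self le_rfl
  have h1 : IntegrableOn (fun p : Rn n × Rn n => u p.1 ^ 2 * truncKernel s (p.1 - p.2))
      (A ×ˢ A) := by
    rw [IntegrableOn, Measure.volume_eq_prod, ← Measure.prod_restrict] at h2' ⊢
    refine h2'.swap.congr (Filter.Eventually.of_forall fun p => ?_)
    simp only [Function.comp_apply, Prod.fst_swap, Prod.snd_swap]
    rw [← truncKernel_neg, neg_sub]
  exact (h1.add h2').congr (Filter.Eventually.of_forall fun p => by
    simp only [Pi.add_apply, add_mul])

/-- At distance `δ` from the diagonal the singular kernel is harmless; this pays for interactions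
between separated sets. -/
lemma inv_le_mul_truncKernel {δ : ℝ} (hδ : 0 < δ) {z : Rn n} (hz : δ ≤ ‖z‖) :
    1 / ‖z‖ ^ ((n : ℝ) + 2 * s) ≤ (min 1 (δ ^ 2))⁻¹ * truncKernel s z := by
  have hz0 : 0 < ‖z‖ := hδ.trans_le hz
  have hm : 0 < min 1 (δ ^ 2) := lt_min one_pos (by positivity)
  unfold truncKernel
  rw [← mul_div_assoc]
  gcongr
  rw [inv_mul_eq_div, le_div_iff₀ hm, one_mul]
  gcongr

lemma sq_div_le_mul_truncKernel {M t : ℝ} {z : Rn n} (h1 : |t| ≤ M) (h2 : |t| ≤ M * ‖z‖) :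
    t ^ 2 / ‖z‖ ^ ((n : ℝ) + 2 * s) ≤ M ^ 2 * truncKernel s z := by
  unfold truncKernel
  rw [← mul_div_assoc]
  gcongr
  rw [← sq_abs t]
  rcases min_choice 1 (‖z‖ ^ 2) with h | h <;> rw [h]
  · rw [mul_one]; gcongr
  · rw [← mul_pow]; gcongr

/-! ### Multiplication, localization, composition -/

/-- Product rule: the increment of `ψ u` is `ψ(x)(u(x) - u(y)) + u(y)(ψ(x) - ψ(y))`. The first term
is controlled by the seminorm of `u`, the second by `u²` times the truncated kernel. -/
lemma MemHs.mul_lipschitz (hn : 1 ≤ n) (hs0 : 0 < s) (hs1 : s < 1) (hu : MemHs s A u)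
    {ψ : Rn n → ℝ} {K : ℝ≥0} (hψ : LipschitzWith K ψ) {M : ℝ}
    (hM : ∀ x, |ψ x| ≤ M) : MemHs s A (fun x => ψ x * u x) := by
  have hψm : Measurable ψ := hψ.continuous.measurable
  have hm : Measurable (fun x => ψ x * u x) := hψm.mul hu.1
  have hM0 : 0 ≤ M := (abs_nonneg _).trans (hM 0)
  refine ⟨hm, ?_, ?_⟩
  · refine Integrable.mono' (hu.2.const_mul (M ^ 2)) (hm.pow_const 2).aestronglyMeasurable
      (Filter.Eventually.of_forall fun x => ?_)
    rw [Real.norm_eq_abs, abs_of_nonneg (sq_nonneg _), mul_pow, ← sq_abs (ψ x)]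
    gcongr
    exact hM x
  -- A single constant dominating both the oscillation `2M` and the Lipschitz constant `K` of `ψ`.
  · set N : ℝ := 2 * M + K with hN
    refine Integrable.mono' ((hu.3.const_mul (2 * M ^ 2)).add
      ((integrableOn_sq_mul_truncKernel hn hs0 hs1 hu.2).const_mul (2 * N ^ 2)))
      (gagliardo_meas s hm hm).aestronglyMeasurable (Filter.Eventually.of_forall fun p => ?_)
    rw [Real.norm_eq_abs, abs_of_nonneg (gagliardo_self_nonneg _ _ _)]
    simp only [Pi.add_apply]
    have hk : (0 : ℝ) ≤ K := K.2
    have hd1 : |ψ p.1 - ψ p.2| ≤ N := by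
      have h1 := hM p.1
      have h2 := hM p.2
      have := abs_sub (ψ p.1) (ψ p.2)
      linarith
    have hd2 : |ψ p.1 - ψ p.2| ≤ N * ‖p.1 - p.2‖ := by
      have := hψ.dist_le_mul p.1 p.2
      rw [Real.dist_eq, dist_eq_norm] at this
      refine this.trans ?_
      gcongr
      linarith
    have key := sq_div_le_mul_truncKernel (s := s) hd1 hd2
    have hk0 := truncKernel_nonneg s (p.1 - p.2)
    rw [gagliardo_self, gagliardo_self]
    set D := ‖p.1 - p.2‖ ^ ((n : ℝ) + 2 * s)
    have hD : 0 ≤ D := by positivity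
    have hnum : (ψ p.1 * u p.1 - ψ p.2 * u p.2) ^ 2 ≤
        2 * M ^ 2 * (u p.1 - u p.2) ^ 2 + 2 * (u p.2 ^ 2 * (ψ p.1 - ψ p.2) ^ 2) := by
      have h1 : ψ p.1 ^ 2 ≤ M ^ 2 := by
        rw [← sq_abs]; gcongr; exact hM _
      have h3 : ψ p.1 ^ 2 * (u p.1 - u p.2) ^ 2 ≤ M ^ 2 * (u p.1 - u p.2) ^ 2 := by gcongr
      nlinarith [sq_nonneg (ψ p.1 * (u p.1 - u p.2) - u p.2 * (ψ p.1 - ψ p.2))]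
    calc (ψ p.1 * u p.1 - ψ p.2 * u p.2) ^ 2 / D
        ≤ (2 * M ^ 2 * (u p.1 - u p.2) ^ 2 + 2 * (u p.2 ^ 2 * (ψ p.1 - ψ p.2) ^ 2)) / D := by
          gcongr
      _ = 2 * M ^ 2 * ((u p.1 - u p.2) ^ 2 / D) +
          2 * (u p.2 ^ 2 * ((ψ p.1 - ψ p.2) ^ 2 / D)) := by ring
      _ ≤ 2 * M ^ 2 * ((u p.1 - u p.2) ^ 2 / D) +
          2 * ((u p.1 ^ 2 + u p.2 ^ 2) * (N ^ 2 * truncKernel s (p.1 - p.2))) := by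
          gcongr
          exact le_add_of_nonneg_left (sq_nonneg _)
      _ = _ := by ring

/-- A pair in `A × A` either lies in `(A ∩ B)²`, or has both values zero, or is at distance at least
`δ`; in the last case the truncated kernel bounds the integrand. -/
lemma MemHs.of_local (hn : 1 ≤ n) (hs0 : 0 < s) (hs1 : s < 1) (hA : MeasurableSet A)
    (hB : MeasurableSet B) (hu : MemHs s (A ∩ B) u) {δ : ℝ} (hδ : 0 < δ)
    (hsupp : ∀ x ∈ A, u x ≠ 0 → x ∈ B ∧ ∀ y ∈ A, y ∉ B → δ ≤ ‖x - y‖) : MemHs s A u := by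
  have hsq : IntegrableOn (fun x => u x ^ 2) A := by
    refine hu.2.of_forall_sdiff_eq_zero hA fun x hx => ?_
    by_contra h
    exact hx.2 ⟨hx.1, (hsupp x hx.1 (by simpa using h)).1⟩
  refine ⟨hu.1, hsq, ?_⟩
  set c : ℝ := (min 1 (δ ^ 2))⁻¹
  have hc : 0 ≤ c := by positivity
  have hAB : MeasurableSet ((A ∩ B) ×ˢ (A ∩ B)) := (hA.inter hB).prod (hA.inter hB)
  have h1 : IntegrableOn (((A ∩ B) ×ˢ (A ∩ B)).indicator (gagliardo s u u)) (A ×ˢ A) :=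
    ((integrable_indicator_iff hAB).2 hu.3).integrableOn
  refine Integrable.mono' (h1.add
      ((integrableOn_sq_mul_truncKernel hn hs0 hs1 hsq).const_mul (2 * c)))
      (gagliardo_meas s hu.1 hu.1).aestronglyMeasurable
      ((ae_restrict_iff' (hA.prod hA)).2 (Filter.Eventually.of_forall fun p hp => ?_))
  rw [Real.norm_eq_abs, abs_of_nonneg (gagliardo_self_nonneg _ _ _)]
  simp only [Pi.add_apply]
  have hk0 := truncKernel_nonneg s (p.1 - p.2)
  by_cases hpB : p ∈ (A ∩ B) ×ˢ (A ∩ B)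
  · rw [indicator_of_mem hpB]
    exact le_add_of_nonneg_right (by positivity)
  rw [indicator_of_notMem hpB, zero_add, gagliardo_self]
  by_cases h0 : u p.1 = 0 ∧ u p.2 = 0
  · rw [h0.1, h0.2]; simp
  have hfar : δ ≤ ‖p.1 - p.2‖ := by
    rcases not_and_or.1 h0 with h | h
    · obtain ⟨h1, h2⟩ := hsupp _ hp.1 h
      exact h2 _ hp.2 fun h3 => hpB ⟨⟨hp.1, h1⟩, hp.2, h3⟩
    · obtain ⟨h1, h2⟩ := hsupp _ hp.2 h
      rw [norm_sub_rev]
      exact h2 _ hp.1 fun h3 => hpB ⟨⟨hp.1, h3⟩, hp.2, h1⟩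
  have hK := inv_le_mul_truncKernel (s := s) hδ hfar
  calc (u p.1 - u p.2) ^ 2 / ‖p.1 - p.2‖ ^ ((n : ℝ) + 2 * s)
      = (u p.1 - u p.2) ^ 2 * (1 / ‖p.1 - p.2‖ ^ ((n : ℝ) + 2 * s)) := by ring
    _ ≤ (2 * (u p.1 ^ 2 + u p.2 ^ 2)) * (c * truncKernel s (p.1 - p.2)) := by
        gcongr
        nlinarith [sq_nonneg (u p.1 + u p.2)]
    _ = _ := by ring

/-- No injectivity of `ρ` is needed: the bound on the pushforward measure replaces the change of
variables, and its square handles pairs. The Lipschitz bound compares the kernels at `(x, y)` and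
`(ρ x, ρ y)`. -/
lemma MemHs.comp_fold (hs0 : 0 < s) (hu : MemHs s A u) {ρ : Rn n → Rn n} {M : ℝ≥0}
    (hρ : LipschitzWith M ρ) {c : ℝ≥0∞} (hc : c ≠ ⊤)
    (hmap : Measure.map ρ volume ≤ c • (volume : Measure (Rn n)).restrict A) :
    MemHs s univ (u ∘ ρ) := by
  have hρm : Measurable ρ := hρ.continuous.measurable
  have hm : Measurable (u ∘ ρ) := hu.1.comp hρm
  refine ⟨hm, ?_, ?_⟩
  · rw [integrableOn_univ]
    exact (((hu.2.smul_measure hc).mono_measure hmap).comp_measurable hρm)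
  · rw [univ_prod_univ, integrableOn_univ]
    have hmap2 : Measure.map (Prod.map ρ ρ) (volume : Measure (Rn n × Rn n)) ≤
        (c * c) • (volume : Measure (Rn n × Rn n)).restrict (A ×ˢ A) := by
      rw [Measure.volume_eq_prod, ← Measure.map_prod_map _ _ hρm hρm, ← Measure.prod_restrict]
      have : SFinite (c • (volume : Measure (Rn n)).restrict A) := inferInstance
      refine (Measure.prod_mono hmap hmap).trans (le_of_eq ?_)
      rw [Measure.prod_smul_left, Measure.prod_smul_right, smul_smul]
    have h := ((hu.3.smul_measure (ENNReal.mul_ne_top hc hc)).mono_measure hmap2).comp_measurable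
      (hρm.prodMap hρm)
    refine Integrable.mono' (h.const_mul ((M : ℝ) ^ ((n : ℝ) + 2 * s)))
      (gagliardo_meas s hm hm).aestronglyMeasurable (Filter.Eventually.of_forall fun p => ?_)
    rw [Real.norm_eq_abs, abs_of_nonneg (gagliardo_self_nonneg _ _ _)]
    simp only [Function.comp_apply, gagliardo_self, Prod.map_fst, Prod.map_snd]
    by_cases h0 : ρ p.1 = ρ p.2
    · simp [h0]
    have hlip := hρ.dist_le_mul p.1 p.2
    rw [dist_eq_norm, dist_eq_norm] at hlip
    have hpos : 0 < ‖ρ p.1 - ρ p.2‖ := norm_pos_iff.2 (sub_ne_zero.2 h0)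
    have hpos' : 0 < ‖p.1 - p.2‖ := norm_pos_iff.2 (sub_ne_zero.2 fun h => h0 (by rw [h]))
    rw [← mul_div_assoc, div_le_div_iff₀ (by positivity) (by positivity)]
    rw [mul_comm ((M : ℝ) ^ _), mul_assoc, ← Real.mul_rpow M.coe_nonneg hpos'.le]
    gcongr

end FracDirichlet

namespace FracDirichlet

/-! ### Reflection across a Lipschitz graph -/

/-- Haar measure is a multiple of Hausdorff measure, which a Lipschitz map enlarges by at most
`K^dim`. For an involution, preimages are images. No differentiability of the map is used. -/
lemma exists_measure_preimage_le_of_involutive {E : Type*} [NormedAddCommGroup E] [NormedSpace ℝ E]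
    [FiniteDimensional ℝ E] [MeasurableSpace E] [BorelSpace E] (μ : Measure E) [μ.IsAddHaarMeasure]
    {Φ : E → E} {K : ℝ≥0} (hΦ : LipschitzWith K Φ) (hinv : Function.Involutive Φ) :
    ∃ C : ℝ≥0, ∀ S : Set E, μ (Φ ⁻¹' S) ≤ C * μ S := by
  refine ⟨K ^ Module.finrank ℝ E, fun S => ?_⟩
  have h := Measure.isAddLeftInvariant_eq_smul μ (Measure.hausdorffMeasure (Module.finrank ℝ E : ℝ))
  rw [h, ← image_eq_preimage_of_inverse hinv.leftInverse hinv.rightInverse]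
  have h2 := hΦ.hausdorffMeasure_image_le (d := Module.finrank ℝ E) (by positivity) S
  rw [ENNReal.rpow_natCast] at h2
  simp only [Measure.smul_apply, ENNReal.smul_def, smul_eq_mul]
  rw [mul_left_comm]
  push_cast
  gcongr

variable {n : ℕ}

/-- The signed height, in the direction `ν`, of a point above the graph of `γ`. -/
noncomputable def graphHeight (ν : Rn n) (γ : Rn n → ℝ) (x : Rn n) : ℝ :=
  inner ℝ ν x - γ (x - inner ℝ ν x • ν)

section Graph

variable {ν : Rn n} {γ : Rn n → ℝ} {L : ℝ≥0}

lemma graphHeight_add_smul (hν : ‖ν‖ = 1) (x : Rn n) (t : ℝ) :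
    graphHeight ν γ (x + t • ν) = graphHeight ν γ x + t := by
  have h1 : inner ℝ ν (x + t • ν) = inner ℝ ν x + t := by
    rw [inner_add_right, inner_smul_right, real_inner_self_eq_norm_sq, hν]; ring
  have h2 : x + t • ν - (inner ℝ ν x + t) • ν = x - inner ℝ ν x • ν := by
    rw [add_smul]; abel
  rw [graphHeight, graphHeight, h1, h2]
  ring

lemma continuous_graphHeight (hγ : Continuous γ) : Continuous (graphHeight ν γ) := by
  unfold graphHeight
  fun_prop

lemma dist_sub_inner_smul_le (hν : ‖ν‖ = 1) (x y : Rn n) :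
    dist (x - inner ℝ ν x • ν) (y - inner ℝ ν y • ν) ≤ dist x y := by
  rw [dist_eq_norm, dist_eq_norm]
  have h : x - inner ℝ ν x • ν - (y - inner ℝ ν y • ν) = (x - y) - inner ℝ ν (x - y) • ν := by
    rw [inner_sub_right, sub_smul]; abel
  rw [h]
  set z := x - y
  refine abs_le_of_sq_le_sq' ?_ (norm_nonneg _) |>.2
  rw [norm_sub_sq_real, norm_smul, inner_smul_right, hν, real_inner_comm, Real.norm_eq_abs, mul_one,
    sq_abs]
  nlinarith [sq_nonneg (inner ℝ ν z)]

lemma lipschitzWith_graphHeight (hν : ‖ν‖ = 1) (hγ : LipschitzWith L γ) :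
    LipschitzWith (1 + L) (graphHeight ν γ) := by
  refine LipschitzWith.of_dist_le_mul fun x y => ?_
  have h1 : |inner ℝ ν (x - y)| ≤ dist x y := by
    have := abs_real_inner_le_norm ν (x - y)
    rwa [hν, one_mul, ← dist_eq_norm] at this
  have h2 := (hγ.dist_le_mul (x - inner ℝ ν x • ν) (y - inner ℝ ν y • ν)).trans
    (mul_le_mul_of_nonneg_left (dist_sub_inner_smul_le hν x y) L.2)
  rw [inner_sub_right] at h1
  rw [Real.dist_eq] at h2 ⊢
  unfold graphHeight
  push_cast
  rw [abs_le] at *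
  constructor <;> linarith [h1.1, h1.2, h2.1, h2.2]

/-- The translates by `ν / (k + 1)` lie on distinct level sets of the height, so infinitely many
bounded translates are disjoint. -/
lemma volume_graphHeight_eq_zero (hν : ‖ν‖ = 1) (hγ : Continuous γ) :
    volume {x | graphHeight ν γ x = 0} = 0 := by
  refine Measure.addHaar_eq_zero_of_disjoint_translates volume
    (fun k : ℕ => (1 / ((k : ℝ) + 1)) • ν) ?_ ?_
    ((continuous_graphHeight hγ).measurable (measurableSet_singleton 0))
  · refine isBounded_iff_forall_norm_le.2 ⟨1, ?_⟩
    rintro _ ⟨k, rfl⟩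
    rw [norm_smul, hν, mul_one, Real.norm_eq_abs, abs_of_nonneg (by positivity)]
    exact div_le_one_of_le₀ (by linarith [k.cast_nonneg (α := ℝ)]) (by positivity)
  · intro j k hjk
    refine Set.disjoint_left.2 fun x hj hk => hjk ?_
    simp only [singleton_add] at hj hk
    obtain ⟨a, ha, rfl⟩ := hj
    obtain ⟨b, hb, hab⟩ := hk
    have h := congrArg (graphHeight ν γ) hab
    simp only [add_comm _ a, add_comm _ b, graphHeight_add_smul hν] at h
    rw [show graphHeight ν γ a = 0 from ha, show graphHeight ν γ b = 0 from hb, zero_add,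
      zero_add, one_div, one_div, inv_inj, add_left_inj, Nat.cast_inj] at h
    exact h.symm

/-- The reflection across the graph of `γ` in the direction `ν`. -/
noncomputable def graphReflection (ν : Rn n) (γ : Rn n → ℝ) (x : Rn n) : Rn n :=
  x + (-2 * graphHeight ν γ x) • ν

/-- The map that folds the region above the graph of `γ` onto the region below. -/
noncomputable def graphFold (ν : Rn n) (γ : Rn n → ℝ) (x : Rn n) : Rn n :=
  x + (-2 * max (graphHeight ν γ x) 0) • ν

lemma graphHeight_graphReflection (hν : ‖ν‖ = 1) (x : Rn n) :
    graphHeight ν γ (graphReflection ν γ x) = -graphHeight ν γ x := by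
  rw [graphReflection, graphHeight_add_smul hν]; ring

lemma graphReflection_involutive (hν : ‖ν‖ = 1) :
    Function.Involutive (graphReflection ν γ) := by
  intro x
  rw [graphReflection, graphHeight_graphReflection hν, graphReflection, add_assoc, ← add_smul]
  ring_nf
  simp

lemma lipschitzWith_add_smul (hν : ‖ν‖ = 1) {f : Rn n → ℝ} {K : ℝ≥0} (hf : LipschitzWith K f) :
    LipschitzWith (1 + 2 * K) (fun x => x + (-2 * f x) • ν) := by
  refine LipschitzWith.of_dist_le_mul fun x y => ?_
  have h := hf.dist_le_mul x y
  refine (dist_add_add_le _ _ _ _).trans ?_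
  rw [dist_eq_norm ((-2 * f x) • ν), ← sub_smul, norm_smul, hν, mul_one, ← mul_sub, norm_mul,
    ← dist_eq_norm]
  push_cast
  norm_num
  linarith

lemma lipschitzWith_graphFold (hν : ‖ν‖ = 1) (hγ : LipschitzWith L γ) :
    LipschitzWith (1 + 2 * (1 + L)) (graphFold ν γ) :=
  lipschitzWith_add_smul hν ((lipschitzWith_graphHeight hν hγ).max_const 0)

lemma graphFold_of_nonpos {x : Rn n} (hx : graphHeight ν γ x ≤ 0) : graphFold ν γ x = x := by
  simp [graphFold, max_eq_right hx]

lemma graphFold_of_nonneg {x : Rn n} (hx : 0 ≤ graphHeight ν γ x) :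
    graphFold ν γ x = graphReflection ν γ x := by
  rw [graphFold, max_eq_left hx, graphReflection]

/-- Off the null graph, the fold is the identity below and the reflection above; these contribute
`1` and `C` to the constant. -/
lemma exists_map_graphFold_le (hν : ‖ν‖ = 1) (hγ : LipschitzWith L γ) :
    ∃ c : ℝ≥0∞, c ≠ ⊤ ∧ Measure.map (graphFold ν γ) volume ≤
      c • (volume : Measure (Rn n)).restrict {x | graphHeight ν γ x < 0} := by
  obtain ⟨C, hC⟩ := exists_measure_preimage_le_of_involutive (volume : Measure (Rn n))
    (lipschitzWith_add_smul hν (lipschitzWith_graphHeight hν hγ))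
    (graphReflection_involutive (γ := γ) hν)
  refine ⟨1 + C, by simp, Measure.le_iff.2 fun E hE => ?_⟩
  have hρ := (lipschitzWith_graphFold hν hγ).continuous.measurable
  rw [Measure.map_apply hρ hE, Measure.smul_apply, Measure.restrict_apply hE, smul_eq_mul]
  set D := {x | graphHeight ν γ x < 0}
  have hsub : graphFold ν γ ⁻¹' E ⊆
      (E ∩ D ∪ graphReflection ν γ ⁻¹' (E ∩ D)) ∪ {x | graphHeight ν γ x = 0} := by
    intro x hx
    rcases lt_trichotomy (graphHeight ν γ x) 0 with h | h | h
    · rw [mem_preimage, graphFold_of_nonpos h.le] at hx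
      exact Or.inl (Or.inl ⟨hx, h⟩)
    · exact Or.inr h
    · rw [mem_preimage, graphFold_of_nonneg h.le] at hx
      refine Or.inl (Or.inr ⟨hx, ?_⟩)
      change graphHeight ν γ _ < 0
      rw [graphHeight_graphReflection hν]
      linarith
  calc volume (graphFold ν γ ⁻¹' E)
      ≤ volume (E ∩ D) + volume (graphReflection ν γ ⁻¹' (E ∩ D)) +
          volume {x | graphHeight ν γ x = 0} :=
        (measure_mono hsub).trans ((measure_union_le _ _).trans
          (add_le_add_left (measure_union_le _ _) _))
    _ ≤ volume (E ∩ D) + C * volume (E ∩ D) + 0 := by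
        gcongr
        · exact hC _
        · exact (volume_graphHeight_eq_zero hν hγ.continuous).le
    _ = (1 + C) * volume (E ∩ D) := by ring

lemma MemHs.comp_graphFold {s : ℝ} (hs0 : 0 < s) (hν : ‖ν‖ = 1) (hγ : LipschitzWith L γ)
    {u : Rn n → ℝ} (hu : MemHs s {x | graphHeight ν γ x < 0} u) :
    MemHs s univ (u ∘ graphFold ν γ) := by
  obtain ⟨c, hc, hmap⟩ := exists_map_graphFold_le hν hγ
  exact hu.comp_fold hs0 (lipschitzWith_graphFold hν hγ) hc hmap

end Graph

/-! ### Local description of a smooth domain -/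

/-- In `ball x₀ r`, the set `Ω` is the region above the graph of the Lipschitz function `γ`. -/
structure IsLocalEpigraph (Ω : Set (Rn n)) (x₀ : Rn n) (r : ℝ) (ν : Rn n) (γ : Rn n → ℝ) :
    Prop where
  norm_eq_one : ‖ν‖ = 1
  pos : 0 < r
  mem_iff : ∀ x ∈ Metric.ball x₀ r, x ∈ Ω ↔ 0 < graphHeight ν γ x

/-- A smooth graph function is only locally Lipschitz, whereas folding needs a global bound. The
function is therefore replaced, on a smaller ball, by a Lipschitz extension of its local
restriction; projecting along `ν` does not increase distances, so the ball projects into the region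
of agreement. -/
lemma HasSmoothBoundary.exists_isLocalEpigraph {Ω : Set (Rn n)} (h : HasSmoothBoundary Ω)
    {x₀ : Rn n} (hx₀ : x₀ ∈ frontier Ω) :
    ∃ r ν γ, IsLocalEpigraph Ω x₀ r ν γ ∧ ∃ L, LipschitzWith L γ := by
  obtain ⟨r, hr, ν, hν, γ, hγ, hΩ⟩ := h x₀ hx₀
  obtain ⟨K, t, ht, hK⟩ :=
    ((hγ.of_le (by exact_mod_cast le_top)).contDiffAt
      (x := x₀ - inner ℝ ν x₀ • ν)).exists_lipschitzOnWith
  obtain ⟨ε, hε, hεt⟩ := Metric.mem_nhds_iff.1 ht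
  obtain ⟨γ', hγ', heq⟩ := hK.extend_real
  refine ⟨min r ε, ν, γ', ⟨hν, lt_min hr hε, fun x hx => ?_⟩, K, hγ'⟩
  have hx1 : x ∈ Metric.ball x₀ r := Metric.ball_subset_ball (min_le_left _ _) hx
  have hx2 : dist x x₀ < ε := lt_of_lt_of_le hx (min_le_right _ _)
  rw [hΩ x hx1, graphHeight, sub_pos, heq (hεt (lt_of_le_of_lt (dist_sub_inner_smul_le hν _ _) hx2))]

section Epigraph

variable {Ω : Set (Rn n)} {x₀ : Rn n} {r : ℝ} {ν : Rn n} {γ : Rn n → ℝ}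

/-- A point on or above the graph is a limit of points of `Ω`, obtained by moving up along `ν`.
Below the graph there is a neighbourhood free of `Ω`. -/
lemma IsLocalEpigraph.mem_exterior_iff (h : IsLocalEpigraph Ω x₀ r ν γ) (hγ : Continuous γ)
    {x : Rn n} (hx : x ∈ Metric.ball x₀ r) : x ∈ exterior Ω ↔ graphHeight ν γ x < 0 := by
  have hball : Metric.ball x₀ r ∈ nhds x := Metric.isOpen_ball.mem_nhds hx
  constructor
  · intro hxe
    by_contra! h0
    refine hxe (mem_closure_iff_frequently.2 ?_)
    have hcont : Filter.Tendsto (fun t : ℝ => x + t • ν) (nhdsWithin 0 (Ioi 0)) (nhds x) := by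
      have : Continuous fun t : ℝ => x + t • ν := by fun_prop
      simpa using (this.tendsto 0).mono_left nhdsWithin_le_nhds
    refine hcont.frequently (Filter.Eventually.frequently ?_)
    filter_upwards [hcont hball, self_mem_nhdsWithin] with t ht ht0
    rw [h.mem_iff _ ht, graphHeight_add_smul h.norm_eq_one]
    exact add_pos_of_nonneg_of_pos h0 ht0
  · intro h0 hcl
    have hopen : {y | graphHeight ν γ y < 0} ∈ nhds x :=
      (isOpen_lt (continuous_graphHeight hγ) continuous_const).mem_nhds h0
    obtain ⟨y, ⟨hy1, hy2⟩, hy3⟩ := mem_closure_iff_nhds.1 hcl _ (Filter.inter_mem hball hopen)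
    have := (h.mem_iff _ hy1).1 hy3
    exact lt_asymm this hy2

lemma IsLocalEpigraph.frontier_inter_subset (h : IsLocalEpigraph Ω x₀ r ν γ) (hγ : Continuous γ)
    (hΩ : IsOpen Ω) : frontier Ω ∩ Metric.ball x₀ r ⊆ {x | graphHeight ν γ x = 0} := by
  rintro x ⟨hx, hxb⟩
  rw [hΩ.frontier_eq] at hx
  have h1 : ¬ 0 < graphHeight ν γ x := fun h2 => hx.2 ((h.mem_iff x hxb).2 h2)
  have h2 : ¬ graphHeight ν γ x < 0 := fun h2 => (h.mem_exterior_iff hγ hxb).2 h2 hx.1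
  exact le_antisymm (not_lt.1 h1) (not_lt.1 h2)

end Epigraph

lemma HasSmoothBoundary.volume_frontier {Ω : Set (Rn n)} (h : HasSmoothBoundary Ω)
    (hΩ : IsOpen Ω) : volume (frontier Ω) = 0 := by
  refine measure_null_of_locally_null _ fun x hx => ?_
  obtain ⟨r, ν, γ, hloc, L, hγ⟩ := h.exists_isLocalEpigraph hx
  refine ⟨frontier Ω ∩ Metric.ball x r, Filter.inter_mem self_mem_nhdsWithin
    (mem_nhdsWithin_of_mem_nhds (Metric.ball_mem_nhds x hloc.pos)), ?_⟩
  exact measure_mono_null (hloc.frontier_inter_subset hγ.continuous hΩ)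
    (volume_graphHeight_eq_zero hloc.norm_eq_one hγ.continuous)

end FracDirichlet

namespace FracDirichlet

/-! ### Extension from the exterior domain -/

variable {n : ℕ} {s : ℝ}

lemma MemHs.add {A : Set (Rn n)} {u v : Rn n → ℝ} (hu : MemHs s A u) (hv : MemHs s A v) :
    MemHs s A (fun x => u x + v x) := by
  refine (hu.toHs + hv.toHs).memHs.congr (hu.1.add hv.1) ?_
  filter_upwards [Lp.coeFn_add hu.toHs.toL2 hv.toHs.toL2, hu.coeFn_toHs, hv.coeFn_toHs]
    with x h1 h2 h3
  rw [← h2, ← h3]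
  exact h1

lemma exists_lipschitz_cutoff (x₀ : Rn n) {a b : ℝ} (ha : 0 < a) (hab : a < b) :
    ∃ (φ : Rn n → ℝ) (K : ℝ≥0), LipschitzWith K φ ∧ (∀ x, 0 ≤ φ x ∧ φ x ≤ 1) ∧
      (∀ x, dist x x₀ ≤ a → φ x = 1) ∧ ∀ x, b ≤ dist x x₀ → φ x = 0 := by
  let φ : ContDiffBump x₀ := ⟨a, b, ha, hab⟩
  obtain ⟨K, hK⟩ := (φ.contDiff (n := 1)).lipschitzWith_of_hasCompactSupport
    φ.hasCompactSupport one_ne_zero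
  exact ⟨φ, K, hK, fun x => ⟨φ.nonneg, φ.le_one⟩,
    fun x hx => φ.one_of_mem_closedBall (Metric.mem_closedBall.2 hx), fun x => φ.zero_of_le_dist⟩

lemma lipschitzWith_mul_of_abs_le_one {f g : Rn n → ℝ} {K L : ℝ≥0} (hf : LipschitzWith K f)
    (hg : LipschitzWith L g) (hf1 : ∀ x, |f x| ≤ 1) (hg1 : ∀ x, |g x| ≤ 1) :
    LipschitzWith (K + L) (fun x => f x * g x) := by
  refine LipschitzWith.of_dist_le_mul fun x y => ?_
  have h1 := hf.dist_le_mul x y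
  have h2 := hg.dist_le_mul x y
  rw [Real.dist_eq] at *
  push_cast
  calc |f x * g x - f y * g y| = |(f x - f y) * g x + f y * (g x - g y)| := by ring_nf
    _ ≤ |f x - f y| * |g x| + |f y| * |g x - g y| := by
        rw [← abs_mul, ← abs_mul]; exact abs_add_le _ _
    _ ≤ (K * dist x y) * 1 + 1 * (L * dist x y) := by
        gcongr
        · exact hg1 x
        · exact hf1 y
    _ = _ := by ring

variable {Ω : Set (Rn n)}

lemma isOpen_exterior (Ω : Set (Rn n)) : IsOpen (exterior Ω) := isClosed_closure.isOpen_compl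

/-- The localized function `φ g` is extended by zero to the whole region below the graph, then
transported above it by the fold. -/
lemma IsLocalEpigraph.exists_extension (hn : 1 ≤ n) (hs0 : 0 < s) (hs1 : s < 1) {x₀ : Rn n} {r : ℝ}
    {ν : Rn n} {γ : Rn n → ℝ} (h : IsLocalEpigraph Ω x₀ r ν γ) {L : ℝ≥0} (hγ : LipschitzWith L γ)
    {g : Rn n → ℝ} (hg : MemHs s (exterior Ω) g) {φ : Rn n → ℝ} {K : ℝ≥0} (hφ : LipschitzWith K φ)
    (hφ1 : ∀ x, |φ x| ≤ 1) (hφ0 : ∀ x, r / 2 ≤ dist x x₀ → φ x = 0) :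
    ∃ w, MemHs s univ w ∧ ∀ x ∈ exterior Ω, w x = φ x * g x := by
  have hr := h.pos
  set D := {x | graphHeight ν γ x < 0}
  have hD : MeasurableSet D :=
    (isOpen_lt (continuous_graphHeight hγ.continuous) continuous_const).measurableSet
  have h1 : MemHs s (D ∩ Metric.ball x₀ r) (fun x => φ x * g x) :=
    (hg.mul_lipschitz hn hs0 hs1 hφ hφ1).mono fun x hx =>
      (h.mem_exterior_iff hγ.continuous hx.2).2 hx.1
  have h2 : MemHs s D (fun x => φ x * g x) := by
    refine h1.of_local hn hs0 hs1 hD measurableSet_ball (half_pos hr) fun x _ hx0 => ?_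
    have hx : dist x x₀ < r / 2 := by
      by_contra! hx
      exact hx0 (by rw [hφ0 x hx, zero_mul])
    refine ⟨Metric.mem_ball.2 (by linarith), fun y _ hy => ?_⟩
    rw [Metric.mem_ball, not_lt] at hy
    rw [← dist_eq_norm]
    have := dist_triangle_left y x₀ x
    linarith
  -- Outside the ball the graph says nothing about `Ω`, and the fold may send an exterior point into
  -- the support of `φ`. A second cutoff, equal to one where `φ` lives, removes these values.
  obtain ⟨χ, K', hχ, hχ1, hχone, hχ0⟩ := exists_lipschitz_cutoff x₀ (half_pos hr) (half_lt_self hr)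
  refine ⟨_, (h2.comp_graphFold hs0 h.norm_eq_one hγ).mul_lipschitz hn hs0 hs1 hχ (M := 1)
    fun x => abs_le.2 ⟨by linarith [(hχ1 x).1], (hχ1 x).2⟩, fun x hx => ?_⟩
  by_cases hxb : x ∈ Metric.ball x₀ r
  · have hxD := (h.mem_exterior_iff hγ.continuous hxb).1 hx
    simp only [Function.comp_apply, graphFold_of_nonpos hxD.le]
    rcases le_total (dist x x₀) (r / 2) with h3 | h3
    · rw [hχone x h3, one_mul]
    · rw [hφ0 x h3, zero_mul, mul_zero]
  · rw [Metric.mem_ball, not_lt] at hxb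
    simp only [hχ0 x hxb, hφ0 x (by linarith), zero_mul]

/-- Near `S`, every function of class `H^s` on the exterior of `Ω` extends to `ℝⁿ`. -/
def IsLocallyExtendable (s : ℝ) (Ω S : Set (Rn n)) : Prop :=
  ∃ (ψ : Rn n → ℝ) (K : ℝ≥0) (U : Set (Rn n)), LipschitzWith K ψ ∧ (∀ x, |ψ x| ≤ 1) ∧ IsOpen U ∧
    S ⊆ U ∧ (∀ x ∈ U, ψ x = 0) ∧ ∀ g : Rn n → ℝ, MemHs s (exterior Ω) g →
      ∃ w, MemHs s univ w ∧ ∀ x ∈ exterior Ω, g x = w x + ψ x * g x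

lemma IsLocalEpigraph.isLocallyExtendable (hn : 1 ≤ n) (hs0 : 0 < s) (hs1 : s < 1) {x₀ : Rn n}
    {r : ℝ} {ν : Rn n} {γ : Rn n → ℝ} (h : IsLocalEpigraph Ω x₀ r ν γ) {L : ℝ≥0}
    (hγ : LipschitzWith L γ) : IsLocallyExtendable s Ω (Metric.ball x₀ (r / 4)) := by
  have hr := h.pos
  obtain ⟨φ, K, hφ, hφ1, hφone, hφ0⟩ :=
    exists_lipschitz_cutoff x₀ (a := r / 4) (b := r / 2) (by linarith) (by linarith)
  refine ⟨fun x => 1 - φ x, 0 + K, Metric.ball x₀ (r / 4), (LipschitzWith.const 1).sub hφ,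
    fun x => abs_le.2 ⟨by linarith [(hφ1 x).2], by linarith [(hφ1 x).1]⟩, Metric.isOpen_ball,
    subset_rfl, fun x hx => sub_eq_zero.2 (hφone x (Metric.mem_ball.1 hx).le).symm, fun g hg => ?_⟩
  obtain ⟨w, hw, hwg⟩ := h.exists_extension hn hs0 hs1 hγ hg hφ
    (fun x => abs_le.2 ⟨by linarith [(hφ1 x).1], (hφ1 x).2⟩) hφ0
  exact ⟨w, hw, fun x hx => by rw [hwg x hx]; ring⟩

lemma isLocallyExtendable_empty : IsLocallyExtendable s Ω ∅ :=
  ⟨fun _ => 1, 0, ∅, LipschitzWith.const 1, by simp, isOpen_empty, subset_rfl, by simp,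
    fun g _ => ⟨fun _ => 0, (0 : SpaceV n s).memHs.congr measurable_const
      (Lp.coeFn_zero ℝ 2 _), by simp⟩⟩

/-- The second extension is applied to the remainder `ψ g` of the first, leaving `ψ ψ' g`.
Remainders multiply, so no partition of unity is needed. -/
lemma IsLocallyExtendable.union (hn : 1 ≤ n) (hs0 : 0 < s) (hs1 : s < 1) {S T : Set (Rn n)}
    (hS : IsLocallyExtendable s Ω S) (hT : IsLocallyExtendable s Ω T) :
    IsLocallyExtendable s Ω (S ∪ T) := by
  obtain ⟨ψ, K, U, hψ, hψ1, hU, hSU, hψ0, hext⟩ := hS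
  obtain ⟨ψ', K', U', hψ', hψ1', hU', hTU', hψ0', hext'⟩ := hT
  refine ⟨fun x => ψ x * ψ' x, K + K', U ∪ U', lipschitzWith_mul_of_abs_le_one hψ hψ' hψ1 hψ1',
    fun x => ?_, hU.union hU', union_subset_union hSU hTU', ?_, fun g hg => ?_⟩
  · rw [abs_mul]
    exact mul_le_one₀ (hψ1 x) (abs_nonneg _) (hψ1' x)
  · rintro x (hx | hx)
    · simp only [hψ0 x hx, zero_mul]
    · simp only [hψ0' x hx, mul_zero]
  · obtain ⟨w, hw, hwg⟩ := hext g hg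
    obtain ⟨w', hw', hwg'⟩ := hext' _ (hg.mul_lipschitz hn hs0 hs1 hψ hψ1)
    refine ⟨_, hw.add hw', fun x hx => ?_⟩
    have h1 := hwg x hx
    have h2 := hwg' x hx
    linarith

lemma HasSmoothBoundary.isLocallyExtendable_frontier (hn : 1 ≤ n) (hs0 : 0 < s) (hs1 : s < 1)
    (hbdd : Bornology.IsBounded Ω) (h : HasSmoothBoundary Ω) :
    IsLocallyExtendable s Ω (frontier Ω) := by
  refine (Metric.isCompact_of_isClosed_isBounded isClosed_frontier
    (hbdd.closure.subset frontier_subset_closure)).induction_on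
    (p := IsLocallyExtendable s Ω) isLocallyExtendable_empty ?_
    (fun S T => IsLocallyExtendable.union hn hs0 hs1) ?_
  · rintro S T hST ⟨ψ, K, U, hψ, hψ1, hU, hTU, hrest⟩
    exact ⟨ψ, K, U, hψ, hψ1, hU, hST.trans hTU, hrest⟩
  · intro x hx
    obtain ⟨r, ν, γ, hloc, L, hγ⟩ := h.exists_isLocalEpigraph hx
    exact ⟨_, mem_nhdsWithin_of_mem_nhds (Metric.ball_mem_nhds x (by linarith [hloc.pos])),
      hloc.isLocallyExtendable hn hs0 hs1 hγ⟩

/-- After subtracting the extendable part, the remainder `ψ g` vanishes on a `δ`-neighbourhood of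
the boundary, hence its extension by zero satisfies `MemHs.of_local`. -/
lemma MemHs.exists_extension (hn : 1 ≤ n) (hs0 : 0 < s) (hs1 : s < 1)
    (hbdd : Bornology.IsBounded Ω) (h : HasSmoothBoundary Ω) {g : Rn n → ℝ}
    (hg : MemHs s (exterior Ω) g) : ∃ w, MemHs s univ w ∧ ∀ x ∈ exterior Ω, w x = g x := by
  obtain ⟨ψ, K, U, hψ, hψ1, hU, hSU, hψ0, hext⟩ :=
    h.isLocallyExtendable_frontier hn hs0 hs1 hbdd
  obtain ⟨w, hw, hwg⟩ := hext g hg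
  obtain ⟨δ, hδ, hδU⟩ := (Metric.isCompact_of_isClosed_isBounded isClosed_frontier
    (hbdd.closure.subset frontier_subset_closure)).exists_thickening_subset_open hU hSU
  have hext_meas : MeasurableSet (exterior Ω) := (isOpen_exterior Ω).measurableSet
  have h1 := hg.mul_lipschitz hn hs0 hs1 hψ hψ1
  set v := (exterior Ω).indicator (fun x => ψ x * g x)
  have h2 : MemHs s (univ ∩ exterior Ω) v := by
    rw [univ_inter]
    exact h1.congr (h1.1.indicator hext_meas) (indicator_ae_eq_restrict hext_meas).symm
  have h3 : MemHs s univ v := by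
    refine h2.of_local hn hs0 hs1 MeasurableSet.univ hext_meas hδ fun x _ hx => ?_
    have hxe : x ∈ exterior Ω := mem_of_indicator_ne_zero hx
    refine ⟨hxe, fun y _ hy => ?_⟩
    by_contra! hlt
    rw [← dist_eq_norm, dist_comm] at hlt
    -- A ball meeting both the exterior and its complement meets the boundary; otherwise the
    -- exterior and the interior of the closure would disconnect it.
    obtain ⟨z, hz1, hz2⟩ : (Metric.ball x δ ∩ frontier (closure Ω)).Nonempty := by
      by_contra hemp
      obtain ⟨z, -, hz1, hz2⟩ := (convex_ball x δ).isPreconnected (exterior Ω)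
        (interior (closure Ω)) (isOpen_exterior Ω) isOpen_interior
        (fun z hz => by
          by_contra! hz'
          rw [mem_union, not_or, mem_compl_iff, not_not] at hz'
          exact hemp ⟨z, hz, subset_closure hz'.1, hz'.2⟩)
        ⟨x, Metric.mem_ball_self hδ, hxe⟩
        ⟨y, hlt, by
          by_contra hy'
          exact hemp ⟨y, hlt, subset_closure (not_not.1 hy), hy'⟩⟩
      exact hz1 (interior_subset hz2)
    have hxU : x ∈ U := hδU (Metric.mem_thickening_iff.2
      ⟨z, frontier_closure_subset hz2, by rwa [dist_comm]⟩)
    refine hx ?_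
    simp only [v, indicator_of_mem hxe, hψ0 x hxU, zero_mul]
  refine ⟨_, hw.add h3, fun x hx => ?_⟩
  simp only [v, indicator_of_mem hx]
  exact (hwg x hx).symm

lemma Hs.restrict_exterior_surjective (hn : 1 ≤ n) (hs0 : 0 < s) (hs1 : s < 1)
    (hbdd : Bornology.IsBounded Ω) (h : HasSmoothBoundary Ω) :
    Function.Surjective (Hs.restrict (s := s) (subset_univ (exterior Ω))) := by
  intro g
  obtain ⟨w, hw, hwg⟩ := g.memHs.exists_extension hn hs0 hs1 hbdd h
  refine ⟨hw.toHs, Hs.ext_ae ((Hs.coeFn_restrict _ _).trans ?_)⟩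
  filter_upwards [ae_mono (Measure.restrict_mono_set volume (subset_univ _)) hw.coeFn_toHs,
    ae_restrict_mem (isOpen_exterior Ω).measurableSet] with x h1 h2
  rw [h1, hwg x h2]

end FracDirichlet

namespace FracDirichlet

variable {n : ℕ} {s : ℝ}

/-! ### Completeness of `H^s(A)` -/

namespace Hs

variable {A : Set (Rn n)}

lemma sq_div_rpow_half (s t : ℝ) (z : Rn n) :
    (t / ‖z‖ ^ (((n : ℝ) + 2 * s) / 2)) ^ 2 = t ^ 2 / ‖z‖ ^ ((n : ℝ) + 2 * s) := by
  rw [div_pow, ← Real.rpow_mul_natCast (norm_nonneg z)]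
  push_cast
  rw [div_mul_cancel₀ _ two_ne_zero]

/-- The difference quotient `(u(x) - u(y)) / |x - y|^(n/2 + s)`. -/
noncomputable def quotFun (s : ℝ) (u : Rn n → ℝ) (p : Rn n × Rn n) : ℝ :=
  (u p.1 - u p.2) / ‖p.1 - p.2‖ ^ (((n : ℝ) + 2 * s) / 2)

lemma quotFun_sq (u : Rn n → ℝ) (p : Rn n × Rn n) : quotFun s u p ^ 2 = gagliardo s u u p := by
  rw [quotFun, sq_div_rpow_half, gagliardo_self]

lemma measurable_quotFun {u : Rn n → ℝ} (hu : Measurable u) : Measurable (quotFun s u) := by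
  unfold quotFun
  fun_prop

lemma memLp_quotFun (u : Hs s A) :
    MemLp (quotFun s u.toL2) 2 ((volume : Measure (Rn n × Rn n)).restrict (A ×ˢ A)) := by
  rw [memLp_two_iff_integrable_sq (measurable_quotFun u.toL2.measurable).aestronglyMeasurable]
  simp only [quotFun_sq]
  exact u.2

/-- The difference quotient of `u ∈ H^s(A)` as an element of `L²(A × A)`. -/
noncomputable def quotLp (u : Hs s A) :
    Lp ℝ 2 ((volume : Measure (Rn n × Rn n)).restrict (A ×ˢ A)) :=
  u.memLp_quotFun.toLp _

lemma quotLp_sub (u v : Hs s A) : (u - v).quotLp = u.quotLp - v.quotLp := by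
  refine Eq.trans ?_ (MemLp.toLp_sub u.memLp_quotFun v.memLp_quotFun)
  refine MemLp.toLp_congr _ _ ?_
  filter_upwards [ae_fst_snd (coeFn_sub u v)] with p hp
  simp only [quotFun, hp.1, hp.2, Pi.sub_apply]
  ring

lemma norm_sq_toL2 (u : Hs s A) : ‖u.toL2‖ ^ 2 = ∫ x in A, u.toL2 x ^ 2 := by
  rw [← real_inner_self_eq_norm_sq, MeasureTheory.L2.inner_def]
  simp only [real_inner_self_eq_norm_sq, Real.norm_eq_abs, sq_abs]

lemma norm_sq_quotLp (u : Hs s A) : ‖u.quotLp‖ ^ 2 = seminormForm u u := by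
  rw [← real_inner_self_eq_norm_sq, MeasureTheory.L2.inner_def, seminormForm]
  refine integral_congr_ae ?_
  filter_upwards [u.memLp_quotFun.coeFn_toLp] with p hp
  rw [quotLp, hp, real_inner_self_eq_norm_sq, Real.norm_eq_abs, sq_abs, quotFun_sq]

lemma norm_sq_eq (u : Hs s A) : ‖u‖ ^ 2 = ‖u.toL2‖ ^ 2 + ‖u.quotLp‖ ^ 2 := by
  rw [norm_sq, norm_sq_quotLp]

lemma toL2_sub (u v : Hs s A) : (u - v).toL2 = u.toL2 - v.toL2 := rfl

lemma lipschitzWith_toL2 : LipschitzWith 1 (toL2 : Hs s A → L2 A) := by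
  refine LipschitzWith.of_dist_le_mul fun u v => ?_
  rw [dist_eq_norm, dist_eq_norm, ← toL2_sub, NNReal.coe_one, one_mul]
  refine abs_le_of_sq_le_sq' ?_ (norm_nonneg _) |>.2
  rw [norm_sq_eq]
  exact le_add_of_nonneg_right (sq_nonneg _)

lemma lipschitzWith_quotLp : LipschitzWith 1 (quotLp : Hs s A → _) := by
  refine LipschitzWith.of_dist_le_mul fun u v => ?_
  rw [dist_eq_norm, dist_eq_norm, ← quotLp_sub, NNReal.coe_one, one_mul]
  refine abs_le_of_sq_le_sq' ?_ (norm_nonneg _) |>.2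
  rw [norm_sq_eq]
  exact le_add_of_nonneg_left (sq_nonneg _)

/-- The difference quotient is a closed operator. -/
lemma exists_of_tendsto {u : ℕ → Hs s A} {U : L2 A}
    {W : Lp ℝ 2 ((volume : Measure (Rn n × Rn n)).restrict (A ×ˢ A))}
    (hU : Filter.Tendsto (fun k => (u k).toL2) Filter.atTop (nhds U))
    (hW : Filter.Tendsto (fun k => (u k).quotLp) Filter.atTop (nhds W)) :
    ∃ v : Hs s A, v.toL2 = U ∧ v.quotLp = W := by
  obtain ⟨a, ha, hUa⟩ := (tendstoInMeasure_of_tendsto_Lp hU).exists_seq_tendsto_ae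
  -- The second subsequence is extracted from the first, so both convergences hold a.e. along it.
  obtain ⟨b, hb, hWb⟩ :=
    (tendstoInMeasure_of_tendsto_Lp (hW.comp ha.tendsto_atTop)).exists_seq_tendsto_ae
  have hae : (W : Rn n × Rn n → ℝ) =ᵐ[volume.restrict (A ×ˢ A)] quotFun s U := by
    have hq : ∀ᵐ p ∂((volume : Measure (Rn n × Rn n)).restrict (A ×ˢ A)), ∀ k,
        (u k).quotLp p = quotFun s (u k).toL2 p :=
      ae_all_iff.2 fun k => (u k).memLp_quotFun.coeFn_toLp
    filter_upwards [hWb, ae_fst_snd hUa, hq] with p h1 h2 h3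
    refine tendsto_nhds_unique h1 ?_
    simp only [Function.comp_apply, h3, quotFun]
    exact ((h2.1.comp hb.tendsto_atTop).sub (h2.2.comp hb.tendsto_atTop)).div_const _
  have hmem : U ∈ sobolevSubmodule s A := by
    have h := (memLp_two_iff_integrable_sq (Lp.memLp W).aestronglyMeasurable).1 (Lp.memLp W)
    refine h.congr ?_
    filter_upwards [hae] with p hp
    rw [hp, quotFun_sq]
  refine ⟨⟨U, hmem⟩, rfl, ?_⟩
  exact Lp.ext ((memLp_quotFun ⟨U, hmem⟩).coeFn_toLp.trans hae.symm)

/-- The norm is that of the pair (`toL2`, `quotLp`) in a sum of two `L²` spaces, and the set of such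
pairs is closed. -/
instance instCompleteSpace : CompleteSpace (Hs s A) := by
  refine Metric.complete_of_cauchySeq_tendsto fun u hu => ?_
  obtain ⟨U, hU⟩ := cauchySeq_tendsto_of_complete 
    (lipschitzWith_toL2.uniformContinuous.comp_cauchySeq hu)
  obtain ⟨W, hW⟩ := cauchySeq_tendsto_of_complete 
    (lipschitzWith_quotLp.uniformContinuous.comp_cauchySeq hu)
  obtain ⟨v, hvU, hvW⟩ := exists_of_tendsto hU hW
  refine ⟨v, ?_⟩
  rw [tendsto_iff_norm_sub_tendsto_zero] at hU hW ⊢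
  have h : Filter.Tendsto (fun k => ‖u k - v‖ ^ 2) Filter.atTop (nhds 0) := by
    have h2 := (hU.pow 2).add (hW.pow 2)
    simp only [ne_eq, OfNat.ofNat_ne_zero, not_false_eq_true, zero_pow, add_zero] at h2
    refine h2.congr fun k => ?_
    rw [norm_sq_eq, toL2_sub, quotLp_sub, hvU, hvW]
    rfl
  have h3 := h.sqrt
  simpa only [Real.sqrt_sq (norm_nonneg _), Real.sqrt_zero] using h3

lemma norm_restrict_le {B : Set (Rn n)} (h : B ⊆ A) (u : Hs s A) : ‖restrict h u‖ ≤ ‖u‖ := by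
  refine abs_le_of_sq_le_sq' ?_ (norm_nonneg _) |>.2
  rw [norm_sq, norm_sq, norm_sq_toL2, norm_sq_toL2]
  refine add_le_add ?_ ?_
  · have hae : (fun x => (restrict h u).toL2 x ^ 2) =ᵐ[volume.restrict B] fun x => u.toL2 x ^ 2 :=
      (coeFn_restrict h u).mono fun x hx => by simp only [hx]
    rw [integral_congr_ae hae]
    exact setIntegral_mono_set u.memHs.2 (Filter.Eventually.of_forall fun x => sq_nonneg _)
      h.eventuallyLE
  · rw [seminormForm, integral_congr_ae (gagliardo_congr_ae (coeFn_restrict h u))]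
    exact setIntegral_mono_set u.memHs.3
      (Filter.Eventually.of_forall fun p => gagliardo_self_nonneg s _ p)
      (prod_mono h h).eventuallyLE

/-- The restriction `H^s(A) → H^s(B)` as a continuous linear map. -/
noncomputable def restrictL {B : Set (Rn n)} (h : B ⊆ A) : Hs s A →L[ℝ] Hs s B :=
  (restrict h).mkContinuous 1 fun u => by simpa using norm_restrict_le h u

end Hs

/-! ### The bilinear form -/

/-- The set `(Ω × ℝⁿ) ∪ (ℝⁿ × Ω)`. -/
abbrev crossSet (Ω : Set (Rn n)) : Set (Rn n × Rn n) :=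
  (Ω ×ˢ (univ : Set (Rn n))) ∪ ((univ : Set (Rn n)) ×ˢ Ω)

variable {Ω : Set (Rn n)}

lemma crossSet_subset : crossSet Ω ⊆ (univ : Set (Rn n)) ×ˢ (univ : Set (Rn n)) := by
  rw [univ_prod_univ]; exact subset_univ _

lemma integrableOn_crossSet (u v : SpaceV n s) :
    IntegrableOn (gagliardo s u.toL2 v.toL2) (crossSet Ω) :=
  (Hs.integrableOn u v).mono_set crossSet_subset

lemma formA_comm (u v : SpaceV n s) : formA Ω u v = formA Ω v u := by
  rw [formA, formA, gagliardo_comm]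

lemma formA_add_left (u v w : SpaceV n s) : formA Ω (u + v) w = formA Ω u w + formA Ω v w := by
  unfold formA
  rw [← mul_add, ← integral_add (integrableOn_crossSet u w) (integrableOn_crossSet v w)]
  congr 1
  exact integral_congr_ae (ae_mono (Measure.restrict_mono_set _ crossSet_subset)
    (gagliardo_add_left s u.toL2 v.toL2 w.toL2))

lemma formA_smul_left (c : ℝ) (u w : SpaceV n s) : formA Ω (c • u) w = c * formA Ω u w := by
  unfold formA
  rw [mul_left_comm, ← integral_const_mul c]
  congr 1
  exact integral_congr_ae (ae_mono (Measure.restrict_mono_set _ crossSet_subset)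
    (gagliardo_smul_left s c u.toL2 w.toL2))

/-- The form `a` as a bilinear map. -/
noncomputable def formALin (s : ℝ) (Ω : Set (Rn n)) : SpaceV n s →ₗ[ℝ] SpaceV n s →ₗ[ℝ] ℝ :=
  LinearMap.mk₂ ℝ (formA Ω) formA_add_left formA_smul_left
    (fun u v w => by rw [formA_comm, formA_add_left, formA_comm v, formA_comm w])
    (fun c u v => by rw [formA_comm, formA_smul_left, formA_comm v, smul_eq_mul])

lemma normConst_pos (hs0 : 0 < s) (hs1 : s < 1) : 0 < normConst n s := by
  have h1 : 0 < Real.Gamma (s + n / 2) := Real.Gamma_pos_of_pos (by positivity)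
  have h2 : 0 < Real.Gamma (1 - s) := Real.Gamma_pos_of_pos (by linarith)
  unfold normConst
  have := Real.pi_pos
  positivity

lemma seminormForm_self_le {A : Set (Rn n)} (u : Hs s A) : Hs.seminormForm u u ≤ ‖u‖ ^ 2 := by
  rw [Hs.norm_sq]; exact le_add_of_nonneg_left (sq_nonneg _)

lemma abs_formA_le_add (hs0 : 0 < s) (hs1 : s < 1) (u v : SpaceV n s) :
    |formA Ω u v| ≤ normConst n s / 2 * (‖u‖ ^ 2 + ‖v‖ ^ 2) := by
  have hc := normConst_pos (n := n) hs0 hs1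
  rw [formA, abs_mul, abs_of_nonneg (by positivity)]
  gcongr
  calc |∫ p in crossSet Ω, gagliardo s u.toL2 v.toL2 p|
      ≤ ∫ p in crossSet Ω, |gagliardo s u.toL2 v.toL2 p| := abs_integral_le_integral_abs
    _ ≤ ∫ p in (univ : Set (Rn n)) ×ˢ (univ : Set (Rn n)), |gagliardo s u.toL2 v.toL2 p| :=
        setIntegral_mono_set (Hs.integrableOn u v).abs
          (Filter.Eventually.of_forall fun _ => abs_nonneg _) crossSet_subset.eventuallyLE
    _ ≤ ∫ p in (univ : Set (Rn n)) ×ˢ (univ : Set (Rn n)),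
          (gagliardo s u.toL2 u.toL2 p + gagliardo s v.toL2 v.toL2 p) :=
        integral_mono (Hs.integrableOn u v).abs
          ((Hs.integrableOn u u).add (Hs.integrableOn v v)) (fun p => abs_gagliardo_le s _ _ p)
    _ = Hs.seminormForm u u + Hs.seminormForm v v :=
        integral_add (Hs.integrableOn u u) (Hs.integrableOn v v)
    _ ≤ _ := add_le_add (seminormForm_self_le u) (seminormForm_self_le v)

/-- Homogeneity: the additive bound is applied to unit vectors and rescaled. -/
lemma LinearMap.abs_le_mul_norm_of_abs_le_add_sq {E : Type*} [NormedAddCommGroup E]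
    [NormedSpace ℝ E] (a : E →ₗ[ℝ] E →ₗ[ℝ] ℝ) {c : ℝ}
    (h : ∀ u v, |a u v| ≤ c * (‖u‖ ^ 2 + ‖v‖ ^ 2)) (u v : E) : |a u v| ≤ 2 * c * ‖u‖ * ‖v‖ := by
  rcases eq_or_ne u 0 with rfl | hu
  · simp
  rcases eq_or_ne v 0 with rfl | hv
  · simp
  have hu' := norm_pos_iff.2 hu
  have hv' := norm_pos_iff.2 hv
  have h1 := h (‖u‖⁻¹ • u) (‖v‖⁻¹ • v)
  simp only [map_smul, LinearMap.smul_apply, smul_eq_mul, norm_smul, norm_inv, norm_norm,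
    inv_mul_cancel₀ hu'.ne', inv_mul_cancel₀ hv'.ne', abs_mul, abs_inv, abs_norm] at h1
  rw [← mul_assoc, ← mul_inv, inv_mul_le_iff₀ (by positivity)] at h1
  linarith

/-- The form `a` as a continuous bilinear map. -/
noncomputable def formACLM (Ω : Set (Rn n)) (hs0 : 0 < s) (hs1 : s < 1) :
    SpaceV n s →L[ℝ] SpaceV n s →L[ℝ] ℝ :=
  (formALin s Ω).mkContinuous₂ (2 * (normConst n s / 2)) fun u v =>
    LinearMap.abs_le_mul_norm_of_abs_le_add_sq (formALin s Ω) (abs_formA_le_add hs0 hs1) u v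

/-! ### Coercivity -/

lemma ae_and_prod {P : Rn n → Prop} (h : ∀ᵐ x, P x) : ∀ᵐ p : Rn n × Rn n, P p.1 ∧ P p.2 := by
  rw [Measure.volume_eq_prod]
  exact (Measure.quasiMeasurePreserving_fst.ae h).and (Measure.quasiMeasurePreserving_snd.ae h)

lemma ae_eq_zero_of_restrict_eq_zero (hnull : volume (frontier Ω) = 0) {u : SpaceV n s}
    (hu : Hs.restrict (subset_univ (exterior Ω)) u = 0) : ∀ᵐ x, x ∉ Ω → u.toL2 x = 0 := by
  have h1 : u.toL2 =ᵐ[volume.restrict (exterior Ω)] 0 := by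
    have h2 := Hs.coeFn_restrict (subset_univ (exterior Ω)) u
    rw [hu] at h2
    exact h2.symm.trans (Lp.coeFn_zero ℝ 2 _)
  have h3 := (ae_restrict_iff' (isOpen_exterior Ω).measurableSet).1 h1
  filter_upwards [h3, measure_eq_zero_iff_ae_notMem.1 hnull] with x hx hxf hxΩ
  refine hx fun hcl => hxf ⟨hcl, fun hint => hxΩ (interior_subset hint)⟩

/-- A pair outside `Q` has both points outside `Ω`, where `u` vanishes. -/
lemma seminormForm_eq_setIntegral_crossSet {u : SpaceV n s}
    (hu : ∀ᵐ x, x ∉ Ω → u.toL2 x = 0) :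
    Hs.seminormForm u u = ∫ p in crossSet Ω, gagliardo s u.toL2 u.toL2 p := by
  have hu' := ae_and_prod hu
  refine setIntegral_eq_of_subset_of_ae_sdiff_eq_zero
    (MeasurableSet.univ.prod MeasurableSet.univ).nullMeasurableSet crossSet_subset ?_
  filter_upwards [hu'] with p hp hpQ
  have h1 : p.1 ∉ Ω := fun h => hpQ.2 (Or.inl ⟨h, mem_univ _⟩)
  have h2 : p.2 ∉ Ω := fun h => hpQ.2 (Or.inr ⟨mem_univ _, h⟩)
  rw [gagliardo, hp.1 h1, hp.2 h2]
  simp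

lemma exists_far_ball (hn : 1 ≤ n) (hbdd : Bornology.IsBounded Ω) :
    ∃ (y₀ : Rn n) (M : ℝ), 0 < M ∧ ∀ y ∈ Metric.ball y₀ 1, y ∉ Ω ∧ ∀ x ∈ Ω, ‖x - y‖ ≤ M := by
  have : Nonempty (Fin n) := ⟨⟨0, hn⟩⟩
  have : Nontrivial (Rn n) := inferInstance
  obtain ⟨R, hR, hΩ⟩ := hbdd.exists_pos_norm_le
  -- With `Ω` in the ball of radius `R`, the unit ball around a point of norm `R + 1` misses `Ω` and
  -- stays within `2R + 2` of it.
  obtain ⟨y₀, hy₀⟩ := exists_norm_eq (Rn n) (show 0 ≤ R + 1 by positivity)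
  refine ⟨y₀, 2 * R + 2, by positivity, fun y hy => ?_⟩
  rw [Metric.mem_ball, dist_eq_norm] at hy
  refine ⟨fun h => ?_, fun x hx => ?_⟩
  · have h1 := norm_sub_norm_le y₀ y
    rw [norm_sub_rev] at h1
    linarith [hΩ y h]
  · have h1 := norm_sub_norm_le y y₀
    linarith [norm_sub_le x y, hΩ x hx]

/-- The fractional Poincaré inequality for functions vanishing outside a bounded set. -/
lemma exists_norm_toL2_sq_le (hn : 1 ≤ n) (hs0 : 0 < s) (hopen : IsOpen Ω)
    (hbdd : Bornology.IsBounded Ω) :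
    ∃ K : ℝ, 0 < K ∧ ∀ u : SpaceV n s, (∀ᵐ x, x ∉ Ω → u.toL2 x = 0) →
      ‖u.toL2‖ ^ 2 ≤ K * Hs.seminormForm u u := by
  obtain ⟨y₀, M, hM, hfar⟩ := exists_far_ball hn hbdd
  set B := Metric.ball y₀ 1
  have hBpos : 0 < volume.real B :=
    ENNReal.toReal_pos (Metric.measure_ball_pos _ _ one_pos).ne' measure_ball_lt_top.ne
  set d := M ^ ((n : ℝ) + 2 * s)
  have hd : 0 < d := by positivity
  refine ⟨d / volume.real B, by positivity, fun u hu => ?_⟩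
  have hu' := ae_and_prod hu
  have hL2 : ‖u.toL2‖ ^ 2 = ∫ x in Ω, u.toL2 x ^ 2 := by
    rw [Hs.norm_sq_toL2]
    refine setIntegral_eq_of_subset_of_ae_sdiff_eq_zero MeasurableSet.univ.nullMeasurableSet
      (subset_univ _) ?_
    filter_upwards [hu] with x hx hxΩ
    rw [hx hxΩ.2, zero_pow two_ne_zero]
  -- On `Ω × B` the second value of `u` is zero and the kernel is at least `1 / d`, so this product
  -- integral bounds the seminorm from below.
  have hprod : ∫ p in Ω ×ˢ B, u.toL2 p.1 ^ 2 * (1 / d) = ‖u.toL2‖ ^ 2 * (volume.real B / d) := by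
    rw [Measure.volume_eq_prod, setIntegral_prod_mul (fun x => u.toL2 x ^ 2) (fun _ => 1 / d),
      hL2, setIntegral_const, smul_eq_mul, mul_one_div]
  have hmeas : MeasurableSet (Ω ×ˢ B) := hopen.measurableSet.prod measurableSet_ball
  have hsub : Ω ×ˢ B ⊆ (univ : Set (Rn n)) ×ˢ (univ : Set (Rn n)) := by
    rw [univ_prod_univ]; exact subset_univ _
  have hle : ∫ p in Ω ×ˢ B, u.toL2 p.1 ^ 2 * (1 / d) ≤ Hs.seminormForm u u := by
    refine le_trans ?_ (setIntegral_mono_set u.memHs.3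
      (Filter.Eventually.of_forall fun p => gagliardo_self_nonneg s _ p) hsub.eventuallyLE)
    refine integral_mono_of_nonneg (Filter.Eventually.of_forall fun p => ?_)
      (u.memHs.3.mono_set hsub) ?_
    · simp only [Pi.zero_apply]; positivity
    · refine (ae_restrict_iff' hmeas).2 ?_
      filter_upwards [hu'] with p hp hpm
      obtain ⟨h1, h2⟩ := hfar p.2 hpm.2
      rw [gagliardo_self, hp.2 h1, sub_zero, mul_one_div]
      have h3 : 0 < ‖p.1 - p.2‖ := norm_pos_iff.2 (sub_ne_zero.2 fun h => h1 (h ▸ hpm.1))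
      have h4 : ‖p.1 - p.2‖ ^ ((n : ℝ) + 2 * s) ≤ d :=
        Real.rpow_le_rpow h3.le (h2 p.1 hpm.1) (by positivity)
      gcongr
  rw [hprod] at hle
  rw [div_mul_eq_mul_div, le_div_iff₀ hBpos]
  rw [mul_div_assoc', div_le_iff₀ hd] at hle
  linarith

lemma exists_coercive_formA (hn : 1 ≤ n) (hs0 : 0 < s) (hs1 : s < 1) (hopen : IsOpen Ω)
    (hbdd : Bornology.IsBounded Ω) (hsmooth : HasSmoothBoundary Ω) :
    ∃ α : ℝ, 0 < α ∧ ∀ u : SpaceV n s, Hs.restrict (subset_univ (exterior Ω)) u = 0 →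
      α * ‖u‖ ^ 2 ≤ formA Ω u u := by
  obtain ⟨K, hK, hpoinc⟩ := exists_norm_toL2_sq_le (s := s) hn hs0 hopen hbdd
  have hc := normConst_pos (n := n) hs0 hs1
  refine ⟨normConst n s / 2 / (K + 1), by positivity, fun u hu => ?_⟩
  have hu0 := ae_eq_zero_of_restrict_eq_zero (hsmooth.volume_frontier hopen) hu
  have h := hpoinc u hu0
  rw [formA, ← seminormForm_eq_setIntegral_crossSet hu0, Hs.norm_sq, div_mul_eq_mul_div,
    mul_div_assoc]
  gcongr
  rw [div_le_iff₀ (by positivity)]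
  linarith

end FracDirichlet

section Brezzi

/-! ### Abstract mixed problems -/

variable {V W : Type*} [NormedAddCommGroup V] [InnerProductSpace ℝ V] [CompleteSpace V]
  [NormedAddCommGroup W] [InnerProductSpace ℝ W] [CompleteSpace W]

/-- A functional vanishing on the kernel of a surjective operator factors through it. -/
lemma exists_dual_comp_eq_of_ker {R : V →L[ℝ] W} (hR : Function.Surjective R)
    (ℓ : StrongDual ℝ V) (hℓ : ∀ v, R v = 0 → ℓ v = 0) :
    ∃ μ : StrongDual ℝ W, ∀ v, μ (R v) = ℓ v := by
  obtain ⟨C, hC, hpre⟩ := R.exists_preimage_norm_le hR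
  -- The linear section `S` need not be continuous. Since `ℓ` ignores the kernel, `ℓ ∘ S` can be
  -- estimated with the controlled preimages of the open mapping theorem instead.
  obtain ⟨S, hS⟩ := R.toLinearMap.exists_rightInverse_of_surjective (LinearMap.range_eq_top.2 hR)
  have hS' : ∀ w, R (S w) = w := fun w => LinearMap.congr_fun hS w
  have heq : ∀ v, ℓ (S (R v)) = ℓ v := fun v => by
    have := hℓ (S (R v) - v) (by rw [map_sub, hS', sub_self])
    rwa [map_sub, sub_eq_zero] at this
  refine ⟨(ℓ.toLinearMap ∘ₗ S).mkContinuous (‖ℓ‖ * C) fun w => ?_, heq⟩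
  obtain ⟨v, rfl, hv⟩ := hpre w
  calc ‖ℓ (S (R v))‖ = ‖ℓ v‖ := by rw [heq]
    _ ≤ ‖ℓ‖ * ‖v‖ := ℓ.le_opNorm v
    _ ≤ ‖ℓ‖ * (C * ‖R v‖) := by gcongr
    _ = _ := by ring

variable {a : V →L[ℝ] V →L[ℝ] ℝ} {R : V →L[ℝ] W} {α : ℝ}

/-- Existence for mixed problems with a form coercive on the kernel of a surjective constraint. -/
lemma exists_mixed_solution (hR : Function.Surjective R) (hα : 0 < α)
    (ha : ∀ v, R v = 0 → α * ‖v‖ ^ 2 ≤ a v v) (F : StrongDual ℝ V) (g : W) :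
    ∃ (u : V) (lam : StrongDual ℝ W), (∀ v, a u v - lam (R v) = F v) ∧ R u = g := by
  obtain ⟨ug, hug⟩ := hR g
  let K : Submodule ℝ V := R.ker
  have : CompleteSpace K := R.isClosed_ker.completeSpace_coe
  let aK : K →L[ℝ] K →L[ℝ] ℝ :=
    (ContinuousLinearMap.compL ℝ K V ℝ).flip K.subtypeL ∘L a ∘L K.subtypeL
  have hco : IsCoercive aK := ⟨α, hα, fun v => by
    have := ha v (LinearMap.mem_ker.1 v.2)
    rw [sq, ← mul_assoc] at this
    exact this⟩
  let ℓ : StrongDual ℝ K := (F - a ug) ∘L K.subtypeL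
  obtain ⟨u₀, hu₀⟩ : ∃ u₀ : K, ∀ v : K, aK u₀ v = ℓ v := by
    refine ⟨hco.continuousLinearEquivOfBilin.symm ((InnerProductSpace.toDual ℝ K).symm ℓ),
      fun v => ?_⟩
    rw [← hco.continuousLinearEquivOfBilin_apply, ContinuousLinearEquiv.apply_symm_apply,
      InnerProductSpace.toDual_symm_apply]
  -- By the choice of `u₀` the residual vanishes on the kernel; the multiplier is its factorization
  -- through `R`.
  obtain ⟨lam, hlam⟩ := exists_dual_comp_eq_of_ker hR (a (ug + u₀) - F) fun v hv => by
    have h : a u₀ v = F v - a ug v := hu₀ ⟨v, hv⟩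
    simp only [map_add, add_apply, sub_apply, h]
    ring
  refine ⟨ug + u₀, lam, fun v => ?_, ?_⟩
  · rw [hlam, sub_apply, sub_sub_cancel]
  · rw [map_add, hug, show R u₀ = 0 from LinearMap.mem_ker.1 u₀.2, add_zero]

/-- Stability for mixed problems with a form coercive on the kernel of a surjective constraint. -/
lemma exists_mixed_bound (hR : Function.Surjective R) (hα : 0 < α)
    (ha : ∀ v, R v = 0 → α * ‖v‖ ^ 2 ≤ a v v) :
    ∃ C : ℝ, 0 < C ∧ ∀ (F : StrongDual ℝ V) (g : W) (u : V) (lam : StrongDual ℝ W),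
      (∀ v, a u v - lam (R v) = F v) → R u = g → ‖u‖ + ‖lam‖ ≤ C * (‖F‖ + ‖g‖) := by
  obtain ⟨c, hc, hpre⟩ := R.exists_preimage_norm_le hR
  set A := ‖a‖
  have hA : 0 ≤ A := norm_nonneg a
  set D := (1 + A * c) / α + c
  have hD : 0 < D := by positivity
  refine ⟨D + (A * D + 1) * c, by positivity, fun F g u lam h1 h2 => ?_⟩
  obtain ⟨ug, hug, hugn⟩ := hpre g
  set N := ‖F‖ + ‖g‖
  have hF : ‖F‖ ≤ N := le_add_of_nonneg_right (norm_nonneg _)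
  have hg : ‖g‖ ≤ N := le_add_of_nonneg_left (norm_nonneg _)
  have hN : 0 ≤ N := (norm_nonneg _).trans hF
  have hug' : ‖ug‖ ≤ c * N := hugn.trans (by gcongr)
  have hbound : ∀ x y, a x y ≤ A * ‖x‖ * ‖y‖ := fun x y =>
    (le_abs_self _).trans (a.le_opNorm₂ x y)
  -- Since `w` lies in the kernel, testing with it eliminates the multiplier and coercivity applies.
  set w := u - ug
  have hw0 : R w = 0 := by rw [map_sub, h2, hug, sub_self]
  have hw : ‖w‖ ≤ (1 + A * c) / α * N := by
    have e1 : a w w = F w + a (-ug) w := by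
      have := h1 w
      rw [hw0, map_zero, sub_zero] at this
      rw [← this, ← add_apply, ← map_add, ← sub_eq_add_neg]
    have e2 : F w ≤ ‖F‖ * ‖w‖ := (le_abs_self _).trans (F.le_opNorm w)
    have e3 := hbound (-ug) w
    rw [norm_neg] at e3
    have e4 := ha w hw0
    rcases (norm_nonneg w).eq_or_lt with h0 | h0
    · rw [← h0]; positivity
    · have e5 : α * ‖w‖ * ‖w‖ ≤ (‖F‖ + A * ‖ug‖) * ‖w‖ := by nlinarith
      have e6 := le_of_mul_le_mul_right e5 h0
      have e7 : A * ‖ug‖ ≤ A * (c * N) := by gcongr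
      rw [div_mul_eq_mul_div, le_div_iff₀ hα]
      linarith
  have hu : ‖u‖ ≤ D * N := by
    have : ‖u‖ ≤ ‖w‖ + ‖ug‖ := by
      simpa [w] using norm_add_le (u - ug) ug
    calc ‖u‖ ≤ (1 + A * c) / α * N + c * N := this.trans (add_le_add hw hug')
      _ = D * N := by ring
  have hlam : ‖lam‖ ≤ (A * D + 1) * c * N := by
    refine lam.opNorm_le_bound (by positivity) fun y => ?_
    obtain ⟨v, rfl, hv⟩ := hpre y
    have e1 : lam (R v) = a u v - F v := by linarith [h1 v]
    rw [e1]
    calc ‖a u v - F v‖ ≤ ‖a u v‖ + ‖F v‖ := norm_sub_le _ _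
      _ ≤ A * ‖u‖ * ‖v‖ + ‖F‖ * ‖v‖ := add_le_add (a.le_opNorm₂ u v) (F.le_opNorm v)
      _ ≤ A * (D * N) * (c * ‖R v‖) + N * (c * ‖R v‖) := by gcongr
      _ = _ := by ring
  calc ‖u‖ + ‖lam‖ ≤ D * N + (A * D + 1) * c * N := add_le_add hu hlam
    _ = _ := by ring

end Brezzi

namespace FracDirichlet

variable {n : ℕ} {s : ℝ} {Ω : Set (Rn n)}

lemma isMixedSolution_iff (hs0 : 0 < s) (hs1 : s < 1) {f : HsDual s Ω} {g : Hs s (exterior Ω)}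
    {u : SpaceV n s} {lam : HsDual s (exterior Ω)} :
    IsMixedSolution Ω f g u lam ↔
      (∀ v, formACLM Ω hs0 hs1 u v - lam (Hs.restrictL (subset_univ (exterior Ω)) v) =
        (f ∘L Hs.restrictL (subset_univ Ω)) v) ∧
      Hs.restrictL (subset_univ (exterior Ω)) u = g := by
  refine and_congr Iff.rfl ⟨fun h => ?_, fun h μ => ?_⟩
  · exact (SeparatingDual.eq_iff_forall_dual_eq (R := ℝ)).2 h
  · rw [← h]; rfl

lemma IsMixedSolution.sub {f f' : HsDual s Ω} {g g' : Hs s (exterior Ω)}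
    {u u' : SpaceV n s} {lam lam' : HsDual s (exterior Ω)} (h : IsMixedSolution Ω f g u lam)
    (h' : IsMixedSolution Ω f' g' u' lam') (hs0 : 0 < s) (hs1 : s < 1) :
    IsMixedSolution Ω (f - f') (g - g') (u - u') (lam - lam') := by
  rw [isMixedSolution_iff hs0 hs1] at *
  refine ⟨fun v => ?_, by rw [map_sub, h.2, h'.2]⟩
  have h1 := h.1 v
  have h2 := h'.1 v
  simp only [map_sub, sub_apply, ContinuousLinearMap.comp_apply] at *
  linarith

end FracDirichlet

open FracDirichlet
theorem mainTheorem6 (n : ℕ) (hn : 1 ≤ n) (s : ℝ) (hs0 : 0 < s) (hs1 : s < 1)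
    (Ω : Set (Rn n)) (hopen : IsOpen Ω) (hbdd : Bornology.IsBounded Ω)
    (hsmooth : HasSmoothBoundary Ω) :
    (∀ (f : HsDual s Ω) (g : Hs s (exterior Ω)),
      ∃! p : SpaceV n s × HsDual s (exterior Ω), IsMixedSolution Ω f g p.1 p.2) ∧
    (∀ (f : HsDual s Ω) (g : Hs s (exterior Ω)) (u : SpaceV n s) (lam : HsDual s (exterior Ω)),
      IsMixedSolution Ω f g u lam → Hs.restrict (subset_univ (exterior Ω)) u = g) ∧
    ∃ C : ℝ, 0 < C ∧ ∀ (f : HsDual s Ω) (g : Hs s (exterior Ω)) (u : SpaceV n s)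
      (lam : HsDual s (exterior Ω)), IsMixedSolution Ω f g u lam →
        ‖u‖ + ‖lam‖ ≤ C * (‖f‖ + ‖g‖) := by
  obtain ⟨α, hα, hco⟩ := exists_coercive_formA (s := s) hn hs0 hs1 hopen hbdd hsmooth
  have hR : Function.Surjective (Hs.restrictL (s := s) (subset_univ (exterior Ω))) :=
    Hs.restrict_exterior_surjective hn hs0 hs1 hbdd hsmooth
  have hco' : ∀ v : SpaceV n s, Hs.restrictL (subset_univ (exterior Ω)) v = 0 →
      α * ‖v‖ ^ 2 ≤ formACLM Ω hs0 hs1 v v := hco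
  have hbound : ∃ C : ℝ, 0 < C ∧ ∀ (f : HsDual s Ω) (g : Hs s (exterior Ω)) (u : SpaceV n s)
      (lam : HsDual s (exterior Ω)), IsMixedSolution Ω f g u lam →
        ‖u‖ + ‖lam‖ ≤ C * (‖f‖ + ‖g‖) := by
    obtain ⟨C, hC, h⟩ := exists_mixed_bound hR hα hco'
    refine ⟨C, hC, fun f g u lam hsol => ?_⟩
    obtain ⟨h1, h2⟩ := (isMixedSolution_iff hs0 hs1).1 hsol
    refine (h _ g u lam h1 h2).trans ?_
    gcongr
    refine ContinuousLinearMap.opNorm_le_bound _ (norm_nonneg f) fun v => ?_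
    exact (f.le_opNorm _).trans
      (mul_le_mul_of_nonneg_left (Hs.norm_restrict_le (subset_univ Ω) v) (norm_nonneg f))
  refine ⟨fun f g => ?_, fun f g u lam h => ((isMixedSolution_iff hs0 hs1).1 h).2, hbound⟩
  obtain ⟨u, lam, h1, h2⟩ := exists_mixed_solution hR hα hco' (f ∘L Hs.restrictL (subset_univ Ω)) g
  have hsol : IsMixedSolution Ω f g u lam := (isMixedSolution_iff hs0 hs1).2 ⟨h1, h2⟩
  refine ⟨(u, lam), hsol, fun p hp => ?_⟩
  -- Uniqueness: the difference of two solutions solves the problem with zero data, so the bound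
  -- forces it to vanish.
  obtain ⟨C, -, h⟩ := hbound
  have h0 := h _ _ _ _ (IsMixedSolution.sub hp hsol hs0 hs1)
  rw [show ‖f - f‖ = 0 by rw [sub_self]; exact ContinuousLinearMap.opNorm_zero,
    show ‖g - g‖ = 0 from norm_eq_zero.2 (sub_self g), add_zero, mul_zero] at h0
  have hu := norm_nonneg (p.1 - u)
  have hl := norm_nonneg (p.2 - lam)
  exact Prod.ext (sub_eq_zero.1 (norm_eq_zero.1 (by linarith)))
    (sub_eq_zero.1 (norm_eq_zero.1 (by linarith)))
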